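/- **Setting.** Let $N\ge 2$. Let $H:\mathbb R^N\to[0,\infty)$ be a gauge, i.e. convex, positively homogeneous of degree $1$ and positive on the unit sphere (not necessarily even). Assume that $H\in C^2(\mathbb R^N\setminus\{0\})$ and that $H$ is uniformly elliptic, i.e. $\{H<1\}$ is uniformly convex: there is $\kappa>0$ with $D^2H(\xi)[\zeta,\zeta]\ge\kappa|\zeta|^2$ whenever $H(\xi)=1$ and $\zeta\perp\nabla H(\xi)$. Put $a(\xi)=H^{N-1}(\xi)\nabla H(\xi)$, $a(0)=0$, and $\Delta_N^Hu=\operatorname{div}(a(\nabla u))$. Let $\Omega\subset\mathbb R^N$ be a bounded domain for which the embedding $W^{1,1}(\Omega)\hookrightarrow L^{N/(N-1)}(\Omega)$ holds, and let $S(\Omega)$ be the least constant with $\|v\|_{L^{N/(N-1)}(\Omega)}\le S(\Omega)\,(\|v\|_{L^1(\Omega)}+\|\nabla v\|_{L^1(\Omega)})$ for all $v\in W^{1,1}(\Omega)$. Let $P\in\mathbb R^N$ and $\Sigma=\{\frac{x-P}{|x-P|} : x\in\Omega,\ x\ne P\}$. Assume property (P): for each $\omega\in\Sigma$ there are an integer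 $K_\omega\ge1$ and radii $0\le\underline r^1_\omega\le\overline r^1_\omega<\underline r^2_\omega\le\overline r^2_\omega<\dots<\underline r^{K_\omega}_\omega\le\overline r^{K_\omega}_\omega$ such that $\{r>0: P+r\omega\in\Omega\}=\bigcup_k(\underline r^k_\omega,\overline r^k_\omega)$ and such that the points $P+\underline r^k_\omega\omega$ and $P+\overline r^k_\omega\omega$ are exactly the points of $\partial\Omega$ on the ray $\{P+r\omega: r\ge0\}$ (except that, if $P\in\Omega$, then $\underline r^1_\omega=0$ and $P\notin\partial\Omega$). Put $\Gamma_P=\partial\Omega\cap\{P+r\omega: r>0,\ \omega\in\Sigma\}$, $\Gamma_P^-=\{P+\underline r^k_\omega\omega\}\cap\Gamma_P$ and $\Gamma_P^+=\Gamma_P\setminus\Gamma_P^-$, and let $d_{r,P}(\Omega)=\sup_{\omega\in\Sigma}\max_k(\overline r^k_\omega-\underline r^k_\omega)$. For $\Gamma\subseteq\partial\Omega$, a function $v\in W^{1,N}(\Omega)$ is said to vanish on $\Gamma$ if it lies in the closure in $W^{1,N}(\Omega)$ of the functions of $W^{1,N}(\Omega)$ that vanish a.e. in $U\cap\Omega$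 for some open $U\supseteq\Gamma$; and $u=h$ on $\Gamma$ means that $u-h$ vanishes on $\Gamma$. **Statement.** There is a constant $c_1>0$, depending only on $N$ and $H$, with $$\langle a(\xi_1)-a(\xi_2),\xi_1-\xi_2\rangle\ge c_1(|\xi_1|+|\xi_2|)^{N-2}|\xi_1-\xi_2|^2\qquad\text{for all }\xi_1,\xi_2\in\mathbb R^N\setminus\{0\},$$ such that for all $\Omega$ and $P$ as above the number $$\mu_\Omega:=\left(\frac{c_1^{1/N}}{S(\Omega)\,(d_{r,P}(\Omega)+1)}\right)^{\frac N{N-1}},$$ which depends only on $N,H,\Omega,P$, is positive and has the following property. Let $\Gamma_P^+\subseteq\Gamma\subseteq\partial\Omega$, let $f\in L^1(\Omega)$, and let $u,h\in W^{1,N}(\Omega)$ be weak solutions of $$-\Delta_N^Hu=f,\quad -\Delta_N^Hh=0\ \text{ in }\Omega,\qquad u=h\ \text{ on }\Gamma,\qquad \langle a(\nabla u),\nu\rangle=\langle a(\nabla h),\nu\rangle=0\ \text{ on }\partial\Omega\setminus\Gamma,$$ that is, $u=h$ on $\Gamma$, and $\int_\Omega\langle a(\nabla u),\nabla\psi\rangle\,dx=\int_\Omega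 f\psi\,dx$ and $\int_\Omega\langle a(\nabla h),\nabla\psi\rangle\,dx=0$ for all $\psi\in W^{1,N}(\Omega)\cap L^\infty(\Omega)$ that vanish on $\Gamma$. Then for every $0<\lambda<\mu_\Omega\|f\|_{L^1(\Omega)}^{-1/(N-1)}$ (every $\lambda>0$ if $f=0$ a.e.), $$\int_\Omega e^{\lambda|u-h|}\,dx\le\frac{\mathcal L^N(\Omega)}{1-\lambda\mu_\Omega^{-1}\|f\|_{L^1(\Omega)}^{1/(N-1)}}.$$ -/

import Mathlib

open MeasureTheory Set
open scoped ENNReal ContDiff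

noncomputable section

/-- A gauge on `ℝ^N`: nonnegative, positively homogeneous of degree one, convex, and positive on
the unit sphere. It need not be even. -/
structure IsGauge {N : ℕ} (H : EuclideanSpace ℝ (Fin N) → ℝ) : Prop where
  nonneg : ∀ ξ, 0 ≤ H ξ
  homog : ∀ t : ℝ, 0 < t → ∀ ξ, H (t • ξ) = t * H ξ
  convex : ConvexOn ℝ univ H
  pos : ∀ ξ, ‖ξ‖ = 1 → 0 < H ξ

/-- Uniform ellipticity of `H` (for `H` of class `C²` away from the origin): the unit ball
`{H < 1}` is uniformly convex, that is, the second fundamental form of its boundary `{H = 1}` is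
bounded below by a positive constant. On tangent vectors that form is `D²H / |∇H|`, and `|∇H|` is
bounded above and below on `{H = 1}`. -/
def UniformlyElliptic {N : ℕ} (H : EuclideanSpace ℝ (Fin N) → ℝ) : Prop :=
  ∃ κ : ℝ, 0 < κ ∧ ∀ ξ, H ξ = 1 → ∀ ζ, inner ℝ (gradient H ξ) ζ = 0 →
    κ * ‖ζ‖ ^ 2 ≤ fderiv ℝ (fderiv ℝ H) ξ ζ ζ

/-- The vector field `a(ξ) = H(ξ)^{N-1} ∇H(ξ)` of the Finsler `N`-Laplacian
`Δ_N^H u = div (a(∇u))`. For a gauge and `N ≥ 2` one gets `a(0) = 0`, the continuous extension. -/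
def finslerField {N : ℕ} (H : EuclideanSpace ℝ (Fin N) → ℝ) (ξ : EuclideanSpace ℝ (Fin N)) :
    EuclideanSpace ℝ (Fin N) :=
  H ξ ^ (N - 1) • gradient H ξ

/-- `v ∈ W^{1,p}(Ω)` with weak gradient `g`. Only the values on `Ω` matter. -/
structure MemSobolev {N : ℕ} (p : ℝ≥0∞) (Ω : Set (EuclideanSpace ℝ (Fin N)))
    (v : EuclideanSpace ℝ (Fin N) → ℝ)
    (g : EuclideanSpace ℝ (Fin N) → EuclideanSpace ℝ (Fin N)) : Prop where
  memLp : MemLp v p (volume.restrict Ω)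
  memLp_grad : MemLp g p (volume.restrict Ω)
  weak_grad : ∀ φ : EuclideanSpace ℝ (Fin N) → ℝ, ContDiff ℝ ∞ φ → HasCompactSupport φ →
    tsupport φ ⊆ Ω → ∫ x in Ω, v x • gradient φ x = -∫ x in Ω, φ x • g x

/-- `v ∈ W^{1,N}(Ω)` (with weak gradient `g`) vanishes on the boundary subset `Γ`: it belongs to
the closure in `W^{1,N}(Ω)` of the functions of `W^{1,N}(Ω)` that vanish in a neighbourhood of `Γ`.
For `Γ = ∂Ω` this is `W_0^{1,N}(Ω)`, for `Γ = ∅` it is `W^{1,N}(Ω)`. -/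
def VanishesOn {N : ℕ} (Ω Γ : Set (EuclideanSpace ℝ (Fin N)))
    (v : EuclideanSpace ℝ (Fin N) → ℝ)
    (g : EuclideanSpace ℝ (Fin N) → EuclideanSpace ℝ (Fin N)) : Prop :=
  MemSobolev (N : ℝ≥0∞) Ω v g ∧
  ∀ ε : ℝ≥0∞, 0 < ε → ∃ (φ : EuclideanSpace ℝ (Fin N) → ℝ)
    (Dφ : EuclideanSpace ℝ (Fin N) → EuclideanSpace ℝ (Fin N))
    (U : Set (EuclideanSpace ℝ (Fin N))),
    MemSobolev (N : ℝ≥0∞) Ω φ Dφ ∧ IsOpen U ∧ Γ ⊆ U ∧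
    (∀ᵐ x ∂(volume.restrict (Ω ∩ U)), φ x = 0) ∧
    eLpNorm (v - φ) (N : ℝ≥0∞) (volume.restrict Ω) ≤ ε ∧
    eLpNorm (g - Dφ) (N : ℝ≥0∞) (volume.restrict Ω) ≤ ε

/-- Weak form of `-Δ_N^H u = f` in `Ω`, `⟨a(∇u), ν⟩ = 0` on `∂Ω ∖ Γ`, for a function with weak
gradient `Du`: the test functions are the bounded functions of `W^{1,N}(Ω)` that vanish
on `Γ`. -/
def IsWeakSolution {N : ℕ} (H : EuclideanSpace ℝ (Fin N) → ℝ)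
    (Ω Γ : Set (EuclideanSpace ℝ (Fin N)))
    (Du : EuclideanSpace ℝ (Fin N) → EuclideanSpace ℝ (Fin N))
    (f : EuclideanSpace ℝ (Fin N) → ℝ) : Prop :=
  ∀ (ψ : EuclideanSpace ℝ (Fin N) → ℝ)
    (Dψ : EuclideanSpace ℝ (Fin N) → EuclideanSpace ℝ (Fin N)),
    VanishesOn Ω Γ ψ Dψ → MemLp ψ ∞ (volume.restrict Ω) →
    ∫ x in Ω, inner ℝ (finslerField H (Du x)) (Dψ x) = ∫ x in Ω, f x * ψ x

/-- `S` is an admissible constant for the embedding `W^{1,1}(Ω) ↪ L^{N/(N-1)}(Ω)`. -/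
def IsSobolevConst {N : ℕ} (Ω : Set (EuclideanSpace ℝ (Fin N))) (S : ℝ) : Prop :=
  0 ≤ S ∧ ∀ (v : EuclideanSpace ℝ (Fin N) → ℝ)
    (g : EuclideanSpace ℝ (Fin N) → EuclideanSpace ℝ (Fin N)), MemSobolev 1 Ω v g →
    eLpNorm v (ENNReal.ofReal ((N : ℝ) / ((N : ℝ) - 1))) (volume.restrict Ω) ≤
      ENNReal.ofReal S *
        (eLpNorm v 1 (volume.restrict Ω) + eLpNorm g 1 (volume.restrict Ω))

/-- The Sobolev constant `S(Ω)`: the least admissible constant. -/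
def sobolevConst {N : ℕ} (Ω : Set (EuclideanSpace ℝ (Fin N))) : ℝ :=
  sInf {S | IsSobolevConst Ω S}

/-- The largest cross-section of `Ω` seen from `P`. -/
def crossSection {N : ℕ} (Ω : Set (EuclideanSpace ℝ (Fin N))) (P : EuclideanSpace ℝ (Fin N)) :
    Set (EuclideanSpace ℝ (Fin N)) :=
  {θ | ∃ x ∈ Ω, x ≠ P ∧ θ = ‖x - P‖⁻¹ • (x - P)}

/-- The open cone with vertex `P` over the cross-section of `Ω`. -/
def radialCone {N : ℕ} (Ω : Set (EuclideanSpace ℝ (Fin N))) (P : EuclideanSpace ℝ (Fin N)) :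
    Set (EuclideanSpace ℝ (Fin N)) :=
  {x | ∃ r : ℝ, 0 < r ∧ ∃ θ ∈ crossSection Ω P, x = P + r • θ}

/-- Radii `0 ≤ lo 1 ≤ hi 1 < lo 2 ≤ hi 2 < ⋯ < lo K ≤ hi K` that describe how the ray from `P` in
direction `θ` meets `Ω` and `∂Ω`: it meets `Ω` in the intervals between `lo k` and `hi k`, and
`∂Ω` exactly in the end points (if `P ∈ Ω`, then `lo 1 = 0` starts the first interval without
being a boundary point). -/
structure IsRaySection {N : ℕ} (Ω : Set (EuclideanSpace ℝ (Fin N)))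
    (P θ : EuclideanSpace ℝ (Fin N)) {K : ℕ} (lo hi : Fin K → ℝ) : Prop where
  pos : 1 ≤ K
  nonneg : ∀ k, 0 ≤ lo k
  le : ∀ k, lo k ≤ hi k
  lt : ∀ j k, j < k → hi j < lo k
  inside : {r : ℝ | 0 < r ∧ P + r • θ ∈ Ω} = ⋃ k, Ioo (lo k) (hi k)
  boundary : {r : ℝ | 0 ≤ r ∧ P + r • θ ∈ frontier Ω} =
    (range lo ∪ range hi) \ {r : ℝ | P + r • θ ∈ Ω}

/-- Property (P) of `Ω` with respect to the radial center `P`. -/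
def PropertyP {N : ℕ} (Ω : Set (EuclideanSpace ℝ (Fin N))) (P : EuclideanSpace ℝ (Fin N)) : Prop :=
  ∀ θ ∈ crossSection Ω P, ∃ (K : ℕ) (lo hi : Fin K → ℝ), IsRaySection Ω P θ lo hi

/-- The radial contact set `Γ_P`. -/
def contactSet {N : ℕ} (Ω : Set (EuclideanSpace ℝ (Fin N))) (P : EuclideanSpace ℝ (Fin N)) :
    Set (EuclideanSpace ℝ (Fin N)) :=
  frontier Ω ∩ radialCone Ω P

/-- The front radial contact set `Γ_P^-`: the points where rays from `P` enter `Ω`, and those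
where `lo k = hi k`. -/
def frontContactSet {N : ℕ} (Ω : Set (EuclideanSpace ℝ (Fin N))) (P : EuclideanSpace ℝ (Fin N)) :
    Set (EuclideanSpace ℝ (Fin N)) :=
  {x | x ∈ contactSet Ω P ∧ ∃ θ ∈ crossSection Ω P, ∃ (K : ℕ) (lo hi : Fin K → ℝ),
    IsRaySection Ω P θ lo hi ∧ ∃ k, x = P + lo k • θ}

/-- The back radial contact set `Γ_P^+ = Γ_P ∖ Γ_P^-`: the points where rays from `P`
leave `Ω`. -/
def backContactSet {N : ℕ} (Ω : Set (EuclideanSpace ℝ (Fin N))) (P : EuclideanSpace ℝ (Fin N)) :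
    Set (EuclideanSpace ℝ (Fin N)) :=
  contactSet Ω P \ frontContactSet Ω P

/-- The radial width `d_{r,P}(Ω)`, the supremum of the lengths `hi k - lo k`. -/
def radialWidth {N : ℕ} (Ω : Set (EuclideanSpace ℝ (Fin N))) (P : EuclideanSpace ℝ (Fin N)) : ℝ :=
  sSup {t | ∃ θ ∈ crossSection Ω P, ∃ (K : ℕ) (lo hi : Fin K → ℝ),
    IsRaySection Ω P θ lo hi ∧ ∃ k, t = hi k - lo k}

/-- The constant `μ_Ω = (c₁^{1/N} / (S(Ω) (d_{r,P}(Ω) + 1)))^{N/(N-1)}`. -/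
def muConst {N : ℕ} (c₁ : ℝ) (Ω : Set (EuclideanSpace ℝ (Fin N)))
    (P : EuclideanSpace ℝ (Fin N)) : ℝ :=
  (c₁ ^ (1 / (N : ℝ)) / (sobolevConst Ω * (radialWidth Ω P + 1))) ^ ((N : ℝ) / ((N : ℝ) - 1))

end

/-!
The energy of `w = u - h` between two levels is controlled by `‖f‖₁`, and this forces the measures
of the level sets of `w` to decay exponentially.

*Strong monotonicity.* On `{H = 1}` the Hessian of `H ^ N / N` is bounded below: ellipticity
controls the directions tangent to the level set, and the term `⟨∇H, ζ⟩ ^ 2` controls the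
remaining one. By homogeneity this bounds the derivative of `s ↦ ⟨a(ξ₂ + s ζ), ζ⟩` with
`ζ = ξ₁ - ξ₂` from below; one integrates over a part of the segment that stays away from the
origin (`exists_finslerField_strongly_monotone`).

*Level sets.* Let `G` be an odd truncation of `w` with slope `1` between the levels `k` and `k + t`
and height about `t`. Testing both equations with `G(w)` and using monotonicity gives
`c₁ ∫ G'(w) |∇w| ^ N ≤ t ‖f‖₁` (`energy_estimate`). The function `|G(w)|` vanishes where rays
from `P` leave `Ω`, so its `L¹` norm is at most `d` times that of its gradient
(`VanishesOn.lintegral_le`), where `d` is the radial width. The Sobolev inequality for `|G(w)|`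
and Hölder's inequality on `{k < |w| < k + t}` then yield, for `m(s) = |{|w| > s}|` and
`A = μ_Ω⁻¹ ‖f‖₁ ^ (1 / (N - 1))`, the inequality `(t + A) m(k + t) ≤ A m(k)`
(`level_set_inequality`). Iteration with steps `s / n`, `n → ∞`, gives `m(s) ≤ |Ω| e ^ (-s / A)`,
and the layer cake formula turns this into the claim (`lintegral_exp_le_of_level_sets`).

*Sobolev functions.* The truncations are taken of class `C¹`, so that the chain rule and the
stability of "vanishing on `Γ`" follow from local mollification and dominated convergence, without
the fact that `∇w = 0` almost everywhere on level sets. For the radial Poincaré inequality,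
smooth local approximations that converge fast enough converge on almost every ray from `P`
(Tonelli in polar coordinates). On such a ray the function is absolutely continuous and vanishes
near each exit radius, and there `r ^ (N - 1)` is an increasing weight.
-/

/-! ### Gauges and strong monotonicity of the field `a` -/

section Gauge

variable {N : ℕ} {H : EuclideanSpace ℝ (Fin N) → ℝ}

theorem contDiffAt_of_ne_zero (hC2 : ContDiffOn ℝ 2 H {0}ᶜ) {ξ : EuclideanSpace ℝ (Fin N)}
    (hξ : ξ ≠ 0) :
    ContDiffAt ℝ 2 H ξ :=
  hC2.contDiffAt (isOpen_compl_singleton.mem_nhds hξ)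

theorem differentiableAt_of_ne_zero (hC2 : ContDiffOn ℝ 2 H {0}ᶜ)
    {ξ : EuclideanSpace ℝ (Fin N)} (hξ : ξ ≠ 0) :
    DifferentiableAt ℝ H ξ :=
  (contDiffAt_of_ne_zero hC2 hξ).differentiableAt (by norm_num)

theorem inner_gradient_eq_fderiv (ξ ζ : EuclideanSpace ℝ (Fin N)) :
    inner ℝ (gradient H ξ) ζ = fderiv ℝ H ξ ζ := by
  simp [gradient]

theorem hasFDerivAt_fderiv_of_ne_zero (hC2 : ContDiffOn ℝ 2 H {0}ᶜ)
    {ξ : EuclideanSpace ℝ (Fin N)} (hξ : ξ ≠ 0) :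
    HasFDerivAt (fderiv ℝ H) (fderiv ℝ (fderiv ℝ H) ξ) ξ :=
  (((contDiffAt_of_ne_zero hC2 hξ).fderiv_right (m := 1) (by norm_num)).differentiableAt
    (by norm_num)).hasFDerivAt

namespace IsGauge

theorem map_zero (hH : IsGauge H) : H 0 = 0 := by
  have := hH.homog 2 two_pos 0
  rw [smul_zero] at this
  linarith

theorem pos_of_ne_zero (hH : IsGauge H) {ξ : EuclideanSpace ℝ (Fin N)} (hξ : ξ ≠ 0) : 0 < H ξ := by
  have hn : 0 < ‖ξ‖ := norm_pos_iff.2 hξ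
  have h1 := hH.pos (‖ξ‖⁻¹ • ξ) (by rw [norm_smul, norm_inv, norm_norm, inv_mul_cancel₀ hn.ne'])
  rw [hH.homog _ (inv_pos.2 hn)] at h1
  exact (pos_iff_pos_of_mul_pos h1).1 (inv_pos.2 hn)

theorem map_add_le (hH : IsGauge H) (x y : EuclideanSpace ℝ (Fin N)) : H (x + y) ≤ H x + H y := by
  obtain ⟨-, hc⟩ := hH.convex
  have h := hc (mem_univ x) (mem_univ y) (a := 1 / 2) (b := 1 / 2)
    (by norm_num) (by norm_num) (by norm_num)
  rw [← smul_add, hH.homog _ (by norm_num)] at h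
  simp only [smul_eq_mul] at h
  linarith

theorem exists_bounds (hH : IsGauge H) :
    ∃ m M : ℝ, 0 < m ∧ 0 < M ∧ ∀ ξ, m * ‖ξ‖ ≤ H ξ ∧ H ξ ≤ M * ‖ξ‖ := by
  have hcont : Continuous H := by
    have := hH.convex.continuousOn isOpen_univ
    exact continuousOn_univ.1 this
  have hc := isCompact_sphere (0 : EuclideanSpace ℝ (Fin N)) 1
  rcases (Metric.sphere (0 : EuclideanSpace ℝ (Fin N)) 1).eq_empty_or_nonempty with he | hne
  · refine ⟨1, 1, one_pos, one_pos, fun ξ => ?_⟩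
    have : ξ = 0 := by
      by_contra hξ
      have hn : 0 < ‖ξ‖ := norm_pos_iff.2 hξ
      have : ‖ξ‖⁻¹ • ξ ∈ Metric.sphere (0 : EuclideanSpace ℝ (Fin N)) 1 := by
        simp [norm_smul, inv_mul_cancel₀ hn.ne']
      rw [he] at this
      exact this
    simp [this, hH.map_zero]
  · obtain ⟨a, ha, hamin⟩ := hc.exists_isMinOn hne hcont.continuousOn
    obtain ⟨b, hb, hbmax⟩ := hc.exists_isMaxOn hne hcont.continuousOn
    refine ⟨H a, H b, hH.pos a (by simpa using ha), hH.pos b (by simpa using hb), fun ξ => ?_⟩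
    rcases eq_or_ne ξ 0 with rfl | hξ
    · simp [hH.map_zero]
    have hn : 0 < ‖ξ‖ := norm_pos_iff.2 hξ
    have hmem : ‖ξ‖⁻¹ • ξ ∈ Metric.sphere (0 : EuclideanSpace ℝ (Fin N)) 1 := by
      simp [norm_smul, inv_mul_cancel₀ hn.ne']
    have h1 := hamin hmem
    have h2 := hbmax hmem
    simp only [mem_ofPred_eq, hH.homog _ (inv_pos.2 hn)] at h1 h2
    rw [inv_mul_eq_div] at h1 h2
    exact ⟨(le_div_iff₀ hn).1 h1, (div_le_iff₀ hn).1 h2⟩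

/-- Euler's identity. -/
theorem fderiv_self (hH : IsGauge H) (hC2 : ContDiffOn ℝ 2 H {0}ᶜ)
    {ξ : EuclideanSpace ℝ (Fin N)} (hξ : ξ ≠ 0) : fderiv ℝ H ξ ξ = H ξ := by
  have h1 : HasDerivAt (fun t : ℝ => H (t • ξ)) (fderiv ℝ H ξ ξ) 1 := by
    have hd := (differentiableAt_of_ne_zero hC2 hξ).hasFDerivAt
    have hl : HasDerivAt (fun t : ℝ => t • ξ) ξ 1 := by
      simpa using (hasDerivAt_id (1 : ℝ)).smul_const ξ
    rw [← one_smul ℝ ξ] at hd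
    have := hd.comp_hasDerivAt (1 : ℝ) hl
    simpa [Function.comp_def] using this
  have h2 : HasDerivAt (fun t : ℝ => t * H ξ) (H ξ) 1 := by
    simpa using (hasDerivAt_id (1 : ℝ)).mul_const (H ξ)
  refine h1.unique (h2.congr_of_eventuallyEq ?_)
  filter_upwards [lt_mem_nhds (zero_lt_one' ℝ)] with t ht using hH.homog t ht ξ

/-- The derivative of a gauge is positively homogeneous of degree zero. -/
theorem fderiv_smul (hH : IsGauge H) (hC2 : ContDiffOn ℝ 2 H {0}ᶜ) {t : ℝ} (ht : 0 < t)
    {ξ : EuclideanSpace ℝ (Fin N)} (hξ : ξ ≠ 0) : fderiv ℝ H (t • ξ) = fderiv ℝ H ξ := by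
  have h1 : HasFDerivAt (fun x => H (t • x)) ((fderiv ℝ H (t • ξ)).comp
      (t • ContinuousLinearMap.id ℝ _)) ξ := by
    have hd := (differentiableAt_of_ne_zero hC2 (smul_ne_zero ht.ne' hξ)).hasFDerivAt
    exact hd.comp ξ ((hasFDerivAt_id ξ).const_smul t)
  have h2 : HasFDerivAt (fun x => H (t • x)) (t • fderiv ℝ H ξ) ξ := by
    simp_rw [hH.homog t ht]
    exact (differentiableAt_of_ne_zero hC2 hξ).hasFDerivAt.const_mul t
  have h3 := h1.unique h2
  ext ζ
  have := congrArg (fun L => L ζ) h3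
  simp at this
  exact this.resolve_right ht.ne'

theorem fderiv_fderiv_self (hH : IsGauge H) (hC2 : ContDiffOn ℝ 2 H {0}ᶜ)
    {ξ : EuclideanSpace ℝ (Fin N)} (hξ : ξ ≠ 0) : fderiv ℝ (fderiv ℝ H) ξ ξ = 0 := by
  have h1 : HasDerivAt (fun t : ℝ => fderiv ℝ H (t • ξ)) (fderiv ℝ (fderiv ℝ H) ξ ξ) 1 := by
    have hd := hasFDerivAt_fderiv_of_ne_zero hC2 hξ
    have hl : HasDerivAt (fun t : ℝ => t • ξ) ξ 1 := by
      simpa using (hasDerivAt_id (1 : ℝ)).smul_const ξ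
    rw [← one_smul ℝ ξ] at hd
    have := hd.comp_hasDerivAt (1 : ℝ) hl
    simpa [Function.comp_def] using this
  refine h1.unique ((hasDerivAt_const (1 : ℝ) (fderiv ℝ H ξ)).congr_of_eventuallyEq ?_)
  filter_upwards [lt_mem_nhds (zero_lt_one' ℝ)] with t ht using fderiv_smul hH hC2 ht hξ

/-- The second derivative of a gauge is positively homogeneous of degree `-1`. -/
theorem fderiv_fderiv_smul (hH : IsGauge H) (hC2 : ContDiffOn ℝ 2 H {0}ᶜ) {t : ℝ} (ht : 0 < t)
    {ξ : EuclideanSpace ℝ (Fin N)} (hξ : ξ ≠ 0) (ζ η : EuclideanSpace ℝ (Fin N)) :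
    t * fderiv ℝ (fderiv ℝ H) (t • ξ) ζ η = fderiv ℝ (fderiv ℝ H) ξ ζ η := by
  have h1 : HasFDerivAt (fun x => fderiv ℝ H (t • x)) ((fderiv ℝ (fderiv ℝ H) (t • ξ)).comp
      (t • ContinuousLinearMap.id ℝ _)) ξ := by
    have hd := hasFDerivAt_fderiv_of_ne_zero hC2 (smul_ne_zero ht.ne' hξ)
    exact hd.comp ξ ((hasFDerivAt_id ξ).const_smul t)
  have h2 := h1.unique ((hasFDerivAt_fderiv_of_ne_zero hC2 hξ).congr_of_eventuallyEq (by
    filter_upwards [isOpen_compl_singleton.mem_nhds hξ] with x hx using fderiv_smul hH hC2 ht hx))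
  have := congrArg (fun L => L ζ η) h2
  simpa using this

/-- The subgradient inequality `H x + ⟨∇H x, y - x⟩ ≤ H y`, simplified by Euler's identity. -/
theorem fderiv_le (hH : IsGauge H) (hC2 : ContDiffOn ℝ 2 H {0}ᶜ)
    {x : EuclideanSpace ℝ (Fin N)} (hx : x ≠ 0) (y : EuclideanSpace ℝ (Fin N)) :
    fderiv ℝ H x y ≤ H y := by
  have h1 : HasDerivAt (fun t : ℝ => H (x + t • y)) (fderiv ℝ H x y) 0 := by
    have hd := (differentiableAt_of_ne_zero hC2 hx).hasFDerivAt
    have hl : HasDerivAt (fun t : ℝ => x + t • y) y 0 := by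
      simpa using ((hasDerivAt_id (0 : ℝ)).smul_const y).const_add x
    have hx0 : x = x + (0 : ℝ) • y := by simp
    rw [hx0] at hd
    have := hd.comp_hasDerivAt (0 : ℝ) hl
    simpa [Function.comp_def] using this
  have h2 := h1.tendsto_slope_zero_right
  refine le_of_tendsto h2 ?_
  filter_upwards [self_mem_nhdsWithin] with t ht
  have ht : 0 < t := ht
  have := hH.map_add_le x (t • y)
  rw [hH.homog t ht] at this
  simp only [zero_add, zero_smul, add_zero, smul_eq_mul]
  rw [inv_mul_le_iff₀ ht]
  linarith

end IsGauge

theorem inner_finslerField (ξ ζ : EuclideanSpace ℝ (Fin N)) :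
    inner ℝ (finslerField H ξ) ζ = H ξ ^ (N - 1) * fderiv ℝ H ξ ζ := by
  rw [finslerField, real_inner_smul_left, inner_gradient_eq_fderiv]

theorem inner_finslerField_self (hN : 2 ≤ N) (hH : IsGauge H) (hC2 : ContDiffOn ℝ 2 H {0}ᶜ)
    (ξ : EuclideanSpace ℝ (Fin N)) : inner ℝ (finslerField H ξ) ξ = H ξ ^ (N - 1) * H ξ := by
  rw [inner_finslerField]
  rcases eq_or_ne ξ 0 with rfl | hξ
  · rw [hH.map_zero, zero_pow (by omega)]; ring
  · rw [hH.fderiv_self hC2 hξ]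

theorem inner_finslerField_le (hN : 2 ≤ N) (hH : IsGauge H) (hC2 : ContDiffOn ℝ 2 H {0}ᶜ)
    (ξ ζ : EuclideanSpace ℝ (Fin N)) : inner ℝ (finslerField H ξ) ζ ≤ H ξ ^ (N - 1) * H ζ := by
  rw [inner_finslerField]
  rcases eq_or_ne ξ 0 with rfl | hξ
  · rw [hH.map_zero, zero_pow (by omega)]; simp
  · exact mul_le_mul_of_nonneg_left (hH.fderiv_le hC2 hξ ζ) (pow_nonneg (hH.nonneg _) _)

/-- Monotonicity follows from the subgradient inequality for `H` alone, so it holds for all vectors,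
including `0` and vectors with `0` on the segment between them. -/
theorem finslerField_monotone (hN : 2 ≤ N) (hH : IsGauge H) (hC2 : ContDiffOn ℝ 2 H {0}ᶜ)
    (x y : EuclideanSpace ℝ (Fin N)) :
    0 ≤ inner ℝ (finslerField H x - finslerField H y) (x - y) := by
  rw [inner_sub_left, inner_sub_right, inner_sub_right, inner_finslerField_self hN hH hC2,
    inner_finslerField_self hN hH hC2]
  have h1 := inner_finslerField_le hN hH hC2 x y
  have h2 := inner_finslerField_le hN hH hC2 y x
  have h3 : 0 ≤ (H x ^ (N - 1) - H y ^ (N - 1)) * (H x - H y) := by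
    rcases le_total (H x) (H y) with h | h
    · exact mul_nonneg_of_nonpos_of_nonpos
        (sub_nonpos.2 (pow_le_pow_left₀ (hH.nonneg _) h _)) (sub_nonpos.2 h)
    · exact mul_nonneg
        (sub_nonneg.2 (pow_le_pow_left₀ (hH.nonneg _) h _)) (sub_nonneg.2 h)
  nlinarith

theorem exists_norm_finslerField_le (hN : 2 ≤ N) (hH : IsGauge H) (hC2 : ContDiffOn ℝ 2 H {0}ᶜ) :
    ∃ C : ℝ, 0 < C ∧ ∀ ξ, ‖finslerField H ξ‖ ≤ C * ‖ξ‖ ^ (N - 1) := by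
  obtain ⟨m, M, hm, hM, hb⟩ := hH.exists_bounds
  refine ⟨M ^ N, by positivity, fun ξ => ?_⟩
  have h1 := inner_finslerField_le hN hH hC2 ξ (finslerField H ξ)
  rw [real_inner_self_eq_norm_sq] at h1
  have h2 : H ξ ^ (N - 1) * H (finslerField H ξ) ≤
      (M * ‖ξ‖) ^ (N - 1) * (M * ‖finslerField H ξ‖) :=
    mul_le_mul (pow_le_pow_left₀ (hH.nonneg _) (hb ξ).2 _) (hb _).2 (hH.nonneg _) (by positivity)
  rcases eq_or_lt_of_le (norm_nonneg (finslerField H ξ)) with h0 | h0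
  · rw [← h0]; positivity
  · refine le_of_mul_le_mul_right ?_ h0
    have hM2 : M ^ N = M ^ (N - 1) * M := by rw [← pow_succ]; congr 1; omega
    rw [hM2]
    calc _ = ‖finslerField H ξ‖ ^ 2 := by ring
      _ ≤ _ := h1.trans h2
      _ = _ := by rw [mul_pow]; ring

theorem measurable_finslerField (hH : IsGauge H) : Measurable (finslerField H) := by
  have hcont : Continuous H := continuousOn_univ.1 (hH.convex.continuousOn isOpen_univ)
  have hg : Measurable (gradient H) :=
    (InnerProductSpace.toDual ℝ (EuclideanSpace ℝ (Fin N))).symm.continuous.measurable.comp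
      (measurable_fderiv ℝ H)
  exact (hcont.measurable.pow_const _).smul hg

/-- Uniform ellipticity in the form in which it is used: on `{H = 1}` the Hessian of `H ^ N / N`
is bounded below. A vector splits into a tangential part, controlled by ellipticity, and a
multiple of `ξ`, controlled by `⟨∇H, ·⟩`. -/
theorem UniformlyElliptic.exists_lower_bound (hH : IsGauge H) (hC2 : ContDiffOn ℝ 2 H {0}ᶜ)
    (hell : UniformlyElliptic H) : ∃ c : ℝ, 0 < c ∧ ∀ ξ, H ξ = 1 → ∀ ζ,
      c * ‖ζ‖ ^ 2 ≤ fderiv ℝ (fderiv ℝ H) ξ ζ ζ + fderiv ℝ H ξ ζ ^ 2 := by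
  obtain ⟨κ, hκ, hell⟩ := hell
  obtain ⟨m, M, hm, hM, hb⟩ := hH.exists_bounds
  refine ⟨min (κ / 2) (m ^ 2 / 2), by positivity, fun ξ hξ1 ζ => ?_⟩
  have hξ : ξ ≠ 0 := by
    rintro rfl
    rw [hH.map_zero] at hξ1
    exact zero_ne_one hξ1
  set τ := fderiv ℝ H ξ ζ with hτ
  set η := ζ - τ • ξ with hη
  have hζ : ζ = τ • ξ + η := by simp [hη]
  have htan : inner ℝ (gradient H ξ) η = 0 := by
    rw [inner_gradient_eq_fderiv, hη, map_sub, map_smul, hH.fderiv_self hC2 hξ, hξ1]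
    simp [hτ]
  have h1 := hell ξ hξ1 η htan
  have hsymm : IsSymmSndFDerivAt ℝ H ξ :=
    (contDiffAt_of_ne_zero hC2 hξ).isSymmSndFDerivAt (by simp)
  have h0 := hH.fderiv_fderiv_self hC2 hξ
  have h2 : fderiv ℝ (fderiv ℝ H) ξ ζ ζ = fderiv ℝ (fderiv ℝ H) ξ η η := by
    have h3 : fderiv ℝ (fderiv ℝ H) ξ η ξ = 0 := by
      rw [hsymm.eq η ξ, h0]; rfl
    conv_lhs => rw [hζ]
    simp [h0, h3]
  have hξn : m * ‖ξ‖ ≤ 1 := hξ1 ▸ (hb ξ).1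
  have hn : ‖ζ‖ ^ 2 ≤ 2 * (τ ^ 2 * ‖ξ‖ ^ 2) + 2 * ‖η‖ ^ 2 := by
    have h4 : ‖ζ‖ ≤ |τ| * ‖ξ‖ + ‖η‖ := by
      conv_lhs => rw [hζ]
      exact (norm_add_le _ _).trans (by rw [norm_smul, Real.norm_eq_abs])
    have h5 : ‖ζ‖ ^ 2 ≤ (|τ| * ‖ξ‖ + ‖η‖) ^ 2 := pow_le_pow_left₀ (norm_nonneg _) h4 2
    have h6 : (|τ| * ‖ξ‖) ^ 2 = τ ^ 2 * ‖ξ‖ ^ 2 := by rw [mul_pow, sq_abs]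
    nlinarith [sq_nonneg (|τ| * ‖ξ‖ - ‖η‖)]
  have hm1 : m ^ 2 * ‖ξ‖ ^ 2 ≤ 1 := by
    rw [← mul_pow]; exact pow_le_one₀ (by positivity) hξn
  rw [h2]
  calc min (κ / 2) (m ^ 2 / 2) * ‖ζ‖ ^ 2
      ≤ min (κ / 2) (m ^ 2 / 2) * (2 * (τ ^ 2 * ‖ξ‖ ^ 2) + 2 * ‖η‖ ^ 2) := by gcongr
    _ = min (κ / 2) (m ^ 2 / 2) * (2 * (τ ^ 2 * ‖ξ‖ ^ 2)) +
        min (κ / 2) (m ^ 2 / 2) * (2 * ‖η‖ ^ 2) := by ring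
    _ ≤ m ^ 2 / 2 * (2 * (τ ^ 2 * ‖ξ‖ ^ 2)) + κ / 2 * (2 * ‖η‖ ^ 2) := by
        gcongr
        · exact min_le_right _ _
        · exact min_le_left _ _
    _ = τ ^ 2 * (m ^ 2 * ‖ξ‖ ^ 2) + κ * ‖η‖ ^ 2 := by ring
    _ ≤ τ ^ 2 * 1 + κ * ‖η‖ ^ 2 := by gcongr
    _ ≤ _ := by linarith

/-- The derivative of `s ↦ ⟨a(y + s ζ), ζ⟩` away from the origin. -/
theorem hasDerivAt_inner_finslerField (hN : 2 ≤ N) (hC2 : ContDiffOn ℝ 2 H {0}ᶜ)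
    (y ζ : EuclideanSpace ℝ (Fin N)) (s : ℝ) (hs : y + s • ζ ≠ 0) :
    HasDerivAt (fun s : ℝ => inner ℝ (finslerField H (y + s • ζ)) ζ)
      (H (y + s • ζ) ^ (N - 2) * (H (y + s • ζ) * fderiv ℝ (fderiv ℝ H) (y + s • ζ) ζ ζ +
        ((N - 1 : ℕ) : ℝ) * fderiv ℝ H (y + s • ζ) ζ ^ 2)) s := by
  simp_rw [inner_finslerField]
  have hl : HasDerivAt (fun t : ℝ => y + t • ζ) ζ s := by
    simpa using ((hasDerivAt_id s).smul_const ζ).const_add y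
  have h1 : HasDerivAt (fun t : ℝ => H (y + t • ζ)) (fderiv ℝ H (y + s • ζ) ζ) s :=
    (differentiableAt_of_ne_zero hC2 hs).hasFDerivAt.comp_hasDerivAt s hl
  have h2 : HasDerivAt (fun t : ℝ => fderiv ℝ H (y + t • ζ))
      (fderiv ℝ (fderiv ℝ H) (y + s • ζ) ζ) s :=
    (hasFDerivAt_fderiv_of_ne_zero hC2 hs).comp_hasDerivAt s hl
  have h3 : HasDerivAt (fun t : ℝ => fderiv ℝ H (y + t • ζ) ζ)
      (fderiv ℝ (fderiv ℝ H) (y + s • ζ) ζ ζ) s := by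
    simpa using h2.clm_apply (hasDerivAt_const s ζ)
  refine ((h1.pow (N - 1)).mul h3).congr_deriv ?_
  obtain ⟨k, rfl⟩ := Nat.exists_eq_add_of_le hN
  have e1 : 2 + k - 1 = k + 1 := by omega
  have e2 : 2 + k - 2 = k := by omega
  simp only [e1, e2, Pi.pow_apply, Nat.add_sub_cancel]
  push_cast
  ring

/-- Strong monotonicity of `a`. The lower bound comes from the stretch `3/4 ≤ s ≤ 1` of the segment
from the shorter vector to the longer one, which stays away from the origin where `H` need not be
differentiable. On the rest of the segment plain monotonicity is enough. -/
theorem exists_finslerField_strongly_monotone (hN : 2 ≤ N) (hH : IsGauge H)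
    (hC2 : ContDiffOn ℝ 2 H {0}ᶜ) (hell : UniformlyElliptic H) :
    ∃ c₁ : ℝ, 0 < c₁ ∧ ∀ ξ₁ ξ₂ : EuclideanSpace ℝ (Fin N),
      c₁ * (‖ξ₁‖ + ‖ξ₂‖) ^ (N - 2) * ‖ξ₁ - ξ₂‖ ^ 2 ≤
        inner ℝ (finslerField H ξ₁ - finslerField H ξ₂) (ξ₁ - ξ₂) := by
  obtain ⟨c, hc, hlow⟩ := hell.exists_lower_bound hH hC2
  obtain ⟨m, M, hm, hM, hb⟩ := hH.exists_bounds
  refine ⟨c * (m / 4) ^ (N - 2) / 4, by positivity, fun ξ₁ ξ₂ => ?_⟩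
  wlog hle : ‖ξ₂‖ ≤ ‖ξ₁‖ generalizing ξ₁ ξ₂
  · have := this ξ₂ ξ₁ (le_of_not_ge hle)
    rwa [add_comm ‖ξ₂‖, norm_sub_rev ξ₂, ← neg_sub (finslerField H ξ₁), ← neg_sub ξ₁,
      inner_neg_neg] at this
  rcases eq_or_ne ξ₁ 0 with rfl | hξ₁
  · have : ξ₂ = 0 := norm_le_zero_iff.1 (by simpa using hle)
    simp [this]
  have hn₁ : 0 < ‖ξ₁‖ := norm_pos_iff.2 hξ₁
  set ζ := ξ₁ - ξ₂ with hζ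
  set g : ℝ → ℝ := fun s => inner ℝ (finslerField H (ξ₂ + s • ζ)) ζ with hg
  have hnorm : ∀ s ∈ Icc (3 / 4 : ℝ) 1, (‖ξ₁‖ + ‖ξ₂‖) / 4 ≤ ‖ξ₂ + s • ζ‖ := by
    intro s hs
    have e : s • ξ₁ = (ξ₂ + s • ζ) - (1 - s) • ξ₂ := by
      rw [hζ, smul_sub, sub_smul, one_smul]; abel
    have h1 : ‖s • ξ₁‖ ≤ ‖ξ₂ + s • ζ‖ + ‖(1 - s) • ξ₂‖ := by
      rw [e]; exact norm_sub_le _ _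
    rw [norm_smul, norm_smul, Real.norm_of_nonneg (by linarith [hs.1]),
      Real.norm_of_nonneg (by linarith [hs.2])] at h1
    nlinarith [hs.1, hs.2]
  have hne : ∀ s ∈ Icc (3 / 4 : ℝ) 1, ξ₂ + s • ζ ≠ 0 := by
    intro s hs h0
    have := hnorm s hs
    rw [h0, norm_zero] at this
    linarith [norm_nonneg ξ₂]
  have hderiv := fun s hs => hasDerivAt_inner_finslerField hN hC2 ξ₂ ζ s (hne s hs)
  have hmv : c * (m / 4) ^ (N - 2) * (‖ξ₁‖ + ‖ξ₂‖) ^ (N - 2) * ‖ζ‖ ^ 2 * (1 - 3 / 4) ≤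
      g 1 - g (3 / 4) := by
    refine Convex.mul_sub_le_image_sub_of_le_deriv (convex_Icc (3 / 4 : ℝ) 1) (f := g)
      (fun s hs => (hderiv s hs).continuousAt.continuousWithinAt)
      (fun s hs => (hderiv s (interior_subset hs)).differentiableAt.differentiableWithinAt)
      ?_ (3 / 4) (by norm_num) 1 (by norm_num) (by norm_num)
    intro s hs
    have hs := interior_subset hs
    rw [(hderiv s hs).deriv]
    set ξ := ξ₂ + s • ζ
    have hξ0 : ξ ≠ 0 := hne s hs
    have hHpos := hH.pos_of_ne_zero hξ0
    set ξ' := (H ξ)⁻¹ • ξ with hξ'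
    have hξ'0 : ξ' ≠ 0 := smul_ne_zero (inv_ne_zero hHpos.ne') hξ0
    have hξ'1 : H ξ' = 1 := by
      rw [hξ', hH.homog _ (inv_pos.2 hHpos), inv_mul_cancel₀ hHpos.ne']
    have hback : ξ = H ξ • ξ' := by rw [hξ', smul_inv_smul₀ hHpos.ne']
    have hD1 : fderiv ℝ H ξ = fderiv ℝ H ξ' := by
      conv_lhs => rw [hback]
      exact hH.fderiv_smul hC2 hHpos hξ'0
    have hD2 : H ξ * fderiv ℝ (fderiv ℝ H) ξ ζ ζ = fderiv ℝ (fderiv ℝ H) ξ' ζ ζ := by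
      have := hH.fderiv_fderiv_smul hC2 hHpos hξ'0 ζ ζ
      rwa [← hback] at this
    rw [hD1, hD2]
    have h1 := hlow ξ' hξ'1 ζ
    have h2 : (1 : ℝ) ≤ ((N - 1 : ℕ) : ℝ) := by exact_mod_cast (by omega : 1 ≤ N - 1)
    have h3 : m * ((‖ξ₁‖ + ‖ξ₂‖) / 4) ≤ H ξ :=
      (mul_le_mul_of_nonneg_left (hnorm s hs) hm.le).trans (hb ξ).1
    calc c * (m / 4) ^ (N - 2) * (‖ξ₁‖ + ‖ξ₂‖) ^ (N - 2) * ‖ζ‖ ^ 2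
        = (m * ((‖ξ₁‖ + ‖ξ₂‖) / 4)) ^ (N - 2) * (c * ‖ζ‖ ^ 2) := by
          rw [show m * ((‖ξ₁‖ + ‖ξ₂‖) / 4) = m / 4 * (‖ξ₁‖ + ‖ξ₂‖) by ring, mul_pow]; ring
      _ ≤ H ξ ^ (N - 2) * (c * ‖ζ‖ ^ 2) := by gcongr
      _ ≤ _ := by
        refine mul_le_mul_of_nonneg_left (h1.trans ?_) (pow_nonneg hHpos.le _)
        gcongr
        nlinarith [sq_nonneg (fderiv ℝ H ξ' ζ)]
  have hrest : g 0 ≤ g (3 / 4) := by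
    have := finslerField_monotone hN hH hC2 (ξ₂ + (3 / 4 : ℝ) • ζ) ξ₂
    rw [add_sub_cancel_left, real_inner_smul_right, inner_sub_left] at this
    simp only [hg, zero_smul, add_zero]
    linarith
  have hg1 : g 1 = inner ℝ (finslerField H ξ₁) ζ := by simp [hg, hζ]
  have hg0 : g 0 = inner ℝ (finslerField H ξ₂) ζ := by simp [hg]
  rw [inner_sub_left, ← hg1, ← hg0]
  linarith

/-- The consequence of strong monotonicity that the energy estimate uses. -/
theorem norm_pow_le_of_strongly_monotone (hN : 2 ≤ N) {c₁ : ℝ} (hc₁ : 0 ≤ c₁)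
    (ξ₁ ξ₂ : EuclideanSpace ℝ (Fin N)) :
    c₁ * ‖ξ₁ - ξ₂‖ ^ N ≤ c₁ * (‖ξ₁‖ + ‖ξ₂‖) ^ (N - 2) * ‖ξ₁ - ξ₂‖ ^ 2 := by
  calc c₁ * ‖ξ₁ - ξ₂‖ ^ N = c₁ * ‖ξ₁ - ξ₂‖ ^ (N - 2) * ‖ξ₁ - ξ₂‖ ^ 2 := by
        rw [mul_assoc, ← pow_add]; congr 2; omega
    _ ≤ _ := by gcongr; exact norm_sub_le _ _

end Gauge

/-! ### Mollification of Sobolev functions -/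

section Mollification

open Filter Topology ContinuousLinearMap
open scoped Convolution

variable {N : ℕ} {F : Type*} [NormedAddCommGroup F] [NormedSpace ℝ F]

/-- Mollification is a contraction of `L¹`. -/
theorem lintegral_enorm_normed_convolution_le (ρ : ContDiffBump (0 : EuclideanSpace ℝ (Fin N)))
    {f : EuclideanSpace ℝ (Fin N) → F} (hf : AEStronglyMeasurable f volume) :
    ∫⁻ x, ‖(ρ.normed volume ⋆[lsmul ℝ ℝ] f) x‖ₑ ≤ ∫⁻ x, ‖f x‖ₑ := by
  have hρ : AEStronglyMeasurable (ρ.normed volume) (volume : Measure (EuclideanSpace ℝ (Fin N))) :=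
    ρ.continuous_normed.aestronglyMeasurable
  calc ∫⁻ x, ‖(ρ.normed volume ⋆[lsmul ℝ ℝ] f) x‖ₑ
      ≤ ∫⁻ x, ∫⁻ t, ‖ρ.normed volume t‖ₑ * ‖f (x - t)‖ₑ := by
        refine lintegral_mono fun x => (enorm_integral_le_lintegral_enorm _).trans_eq ?_
        refine lintegral_congr fun t => ?_
        rw [lsmul_apply, enorm_smul]
    _ = ∫⁻ t, ∫⁻ x, ‖ρ.normed volume t‖ₑ * ‖f (x - t)‖ₑ := by
        refine lintegral_lintegral_swap ?_
        have := (AEStronglyMeasurable.convolution_integrand (lsmul ℝ ℝ) hρ hf).enorm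
        refine this.congr (Eventually.of_forall fun p => ?_)
        simp [enorm_smul, Function.uncurry]
    _ = ∫⁻ t, ‖ρ.normed volume t‖ₑ * ∫⁻ x, ‖f x‖ₑ := by
        refine lintegral_congr fun t => ?_
        rw [lintegral_const_mul' _ _ enorm_ne_top,
          lintegral_sub_right_eq_self (fun x => ‖f x‖ₑ) t]
    _ = (∫⁻ t, ‖ρ.normed volume t‖ₑ) * ∫⁻ x, ‖f x‖ₑ := by
        rw [lintegral_mul_const'' _ hρ.enorm]
    _ = ∫⁻ x, ‖f x‖ₑ := by
        have h1 : ∫⁻ t, ‖ρ.normed volume t‖ₑ = 1 := by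
          rw [← ofReal_integral_norm_eq_lintegral_enorm ρ.integrable_normed]
          simp_rw [Real.norm_of_nonneg (ρ.nonneg_normed _)]
          rw [ρ.integral_normed, ENNReal.ofReal_one]
        rw [h1, one_mul]

/-- Mollification converges in `L¹`: approximate by a continuous function with compact support,
for which the convergence is uniform. -/
theorem exists_normed_convolution_sub_le [CompleteSpace F] {f : EuclideanSpace ℝ (Fin N) → F}
    (hf : Integrable f volume) {ε : ℝ≥0∞} (hε : ε ≠ 0) :
    ∃ δ : ℝ, 0 < δ ∧ ∀ ρ : ContDiffBump (0 : EuclideanSpace ℝ (Fin N)), ρ.rOut ≤ δ →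
      ∫⁻ x, ‖(ρ.normed volume ⋆[lsmul ℝ ℝ] f) x - f x‖ₑ ≤ ε := by
  have hε3 : ε / 3 ≠ 0 := (ENNReal.div_pos hε (by norm_num)).ne'
  obtain ⟨k, hkc, hfk, hkcont, hkint⟩ := hf.exists_hasCompactSupport_lintegral_sub_le hε3
  set K := Metric.cthickening 1 (tsupport k)
  have hKc : IsCompact K := IsCompact.cthickening hkc
  have hV : volume K ≠ ⊤ := hKc.measure_lt_top.ne
  obtain ⟨η, hη0, hη⟩ : ∃ η : ℝ, 0 < η ∧ ENNReal.ofReal η * volume K ≤ ε / 3 := by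
    obtain ⟨η, h0, h1⟩ := ENNReal.exists_nnreal_pos_mul_lt hV hε3
    exact ⟨η, h0, by rw [ENNReal.ofReal_coe_nnreal]; exact h1.le⟩
  obtain ⟨δ, hδ0, hδ⟩ := Metric.uniformContinuous_iff.1
    (hkc.uniformContinuous_of_continuous hkcont) η hη0
  refine ⟨min δ 1, by positivity, fun ρ hρ => ?_⟩
  have hρδ : ρ.rOut ≤ δ := hρ.trans (min_le_left _ _)
  have hρ1 : ρ.rOut ≤ 1 := hρ.trans (min_le_right _ _)
  have hunif : ∀ x, ‖(ρ.normed volume ⋆[lsmul ℝ ℝ] k) x - k x‖ₑ ≤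
      K.indicator (fun _ => ENNReal.ofReal η) x := by
    intro x
    by_cases hx : x ∈ K
    · rw [indicator_of_mem hx, ← edist_eq_enorm_sub, edist_dist]
      refine ENNReal.ofReal_le_ofReal ?_
      refine ρ.dist_normed_convolution_le hkcont.aestronglyMeasurable fun y hy => ?_
      exact (hδ (lt_of_lt_of_le hy hρδ)).le
    · have hz : ∀ y ∈ Metric.ball x ρ.rOut, k y = 0 := by
        intro y hy
        by_contra hne
        exact hx (Metric.mem_cthickening_of_dist_le x y 1 _ (subset_tsupport k hne)
          (by rw [dist_comm]; exact (lt_of_lt_of_le hy hρ1).le))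
      rw [ρ.normed_convolution_eq_right (fun y hy => by
        rw [hz y hy, hz x (Metric.mem_ball_self ρ.rOut_pos)])]
      simp
  have hsplit : ∀ x, (ρ.normed volume ⋆[lsmul ℝ ℝ] f) x - f x =
      (ρ.normed volume ⋆[lsmul ℝ ℝ] (f - k)) x +
        ((ρ.normed volume ⋆[lsmul ℝ ℝ] k) x - k x) + (k x - f x) := by
    intro x
    have hex : ∀ g : EuclideanSpace ℝ (Fin N) → F, Integrable g volume →
        ConvolutionExistsAt (ρ.normed volume) g x (lsmul ℝ ℝ) volume := fun g hg =>
      ρ.hasCompactSupport_normed.convolutionExists_left (lsmul ℝ ℝ) ρ.continuous_normed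
        hg.locallyIntegrable x
    have h := (hex _ (hf.sub hkint)).distrib_add (hex _ hkint)
    rw [sub_add_cancel] at h
    rw [h]
    abel
  calc ∫⁻ x, ‖(ρ.normed volume ⋆[lsmul ℝ ℝ] f) x - f x‖ₑ
      ≤ ∫⁻ x, (‖(ρ.normed volume ⋆[lsmul ℝ ℝ] (f - k)) x‖ₑ +
          K.indicator (fun _ => ENNReal.ofReal η) x + ‖f x - k x‖ₑ) := by
        refine lintegral_mono fun x => ?_
        rw [hsplit x]
        refine (enorm_add_le _ _).trans (add_le_add ((enorm_add_le _ _).trans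
          (add_le_add le_rfl (hunif x))) ?_)
        rw [← edist_eq_enorm_sub, ← edist_eq_enorm_sub, edist_comm]
    _ = (∫⁻ x, (‖(ρ.normed volume ⋆[lsmul ℝ ℝ] (f - k)) x‖ₑ +
          K.indicator (fun _ => ENNReal.ofReal η) x)) + ∫⁻ x, ‖f x - k x‖ₑ :=
        lintegral_add_right' _ (hf.sub hkint).aestronglyMeasurable.enorm
    _ = (∫⁻ x, ‖(ρ.normed volume ⋆[lsmul ℝ ℝ] (f - k)) x‖ₑ) +
          ENNReal.ofReal η * volume K + ∫⁻ x, ‖f x - k x‖ₑ := by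
        rw [lintegral_add_right _ (measurable_const.indicator hKc.measurableSet),
          lintegral_indicator_const hKc.measurableSet]
    _ ≤ ε / 3 + ε / 3 + ε / 3 := by
        gcongr
        exact (lintegral_enorm_normed_convolution_le ρ
          (hf.sub hkint).aestronglyMeasurable).trans hfk
    _ = ε := ENNReal.add_thirds ε

theorem continuous_gradient_of_contDiff {φ : EuclideanSpace ℝ (Fin N) → ℝ}
    (hφ : ContDiff ℝ ∞ φ) : Continuous (gradient φ) :=
  (InnerProductSpace.toDual ℝ (EuclideanSpace ℝ (Fin N))).symm.continuous.comp
    (hφ.continuous_fderiv (by simp))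

/-- The weak gradient formula in a fixed direction. -/
theorem MemSobolev.integral_mul_fderiv {Ω : Set (EuclideanSpace ℝ (Fin N))}
    {v : EuclideanSpace ℝ (Fin N) → ℝ} {g : EuclideanSpace ℝ (Fin N) → EuclideanSpace ℝ (Fin N)}
    (hv : MemSobolev 1 Ω v g) {φ : EuclideanSpace ℝ (Fin N) → ℝ} (hφ : ContDiff ℝ ∞ φ)
    (hc : HasCompactSupport φ) (hs : tsupport φ ⊆ Ω) (e : EuclideanSpace ℝ (Fin N)) :
    ∫ x in Ω, v x * fderiv ℝ φ x e = -∫ x in Ω, φ x * inner ℝ (g x) e := by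
  have h := congrArg (fun z => inner ℝ e z) (hv.weak_grad φ hφ hc hs)
  have hvi : Integrable v (volume.restrict Ω) := memLp_one_iff_integrable.1 hv.memLp
  have hgi : Integrable g (volume.restrict Ω) := memLp_one_iff_integrable.1 hv.memLp_grad
  have hgradc : Continuous (gradient φ) :=
    continuous_gradient_of_contDiff hφ
  obtain ⟨C, hC⟩ := hc.exists_bound_of_continuous hφ.continuous
  obtain ⟨C', hC'⟩ := (hc.fderiv (𝕜 := ℝ)).exists_bound_of_continuous
    (hφ.continuous_fderiv (by simp))
  have hi1 : Integrable (fun x => v x • gradient φ x) (volume.restrict Ω) := by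
    refine hvi.smul_bdd C' hgradc.aestronglyMeasurable (Eventually.of_forall fun x => ?_)
    simpa [gradient] using hC' x
  have hi2 : Integrable (fun x => φ x • g x) (volume.restrict Ω) :=
    hgi.bdd_smul C hφ.continuous.aestronglyMeasurable (Eventually.of_forall hC)
  simp only [inner_neg_right] at h
  rw [← integral_inner hi1, ← integral_inner hi2] at h
  simp only [real_inner_comm _ e] at h
  simp only [real_inner_smul_left, inner_gradient_eq_fderiv] at h
  exact h

/-- Differentiating a mollification of `v` gives the mollification of the weak gradient. -/
theorem MemSobolev.gradient_normed_convolution {Ω : Set (EuclideanSpace ℝ (Fin N))}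
    (hΩ : IsOpen Ω)
    {v : EuclideanSpace ℝ (Fin N) → ℝ} {g : EuclideanSpace ℝ (Fin N) → EuclideanSpace ℝ (Fin N)}
    (hv : MemSobolev 1 Ω v g) (ρ : ContDiffBump (0 : EuclideanSpace ℝ (Fin N)))
    {x : EuclideanSpace ℝ (Fin N)} (hx : Metric.closedBall x ρ.rOut ⊆ Ω) :
    gradient (ρ.normed volume ⋆[lsmul ℝ ℝ] Ω.indicator v) x =
      (ρ.normed volume ⋆[lsmul ℝ ℝ] Ω.indicator g) x := by
  have hvi : Integrable (Ω.indicator v) volume :=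
    (integrable_indicator_iff hΩ.measurableSet).2 (memLp_one_iff_integrable.1 hv.memLp)
  have hgi : Integrable (Ω.indicator g) volume :=
    (integrable_indicator_iff hΩ.measurableSet).2 (memLp_one_iff_integrable.1 hv.memLp_grad)
  have hρ : ContDiff ℝ ∞ (ρ.normed (volume : Measure (EuclideanSpace ℝ (Fin N)))) :=
    ρ.contDiff_normed
  have hd := ρ.hasCompactSupport_normed.hasFDerivAt_convolution_left (lsmul ℝ ℝ)
    (hρ.of_le (by simp)) hvi.locallyIntegrable x
  refine ext_inner_right ℝ fun e => ?_
  rw [inner_gradient_eq_fderiv, hd.fderiv]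
  set η : EuclideanSpace ℝ (Fin N) → ℝ := fun y => ρ.normed volume (x - y) with hη
  have hηs : ContDiff ℝ ∞ η := hρ.comp (contDiff_const.sub contDiff_id)
  have hηt : tsupport η ⊆ Metric.closedBall x ρ.rOut := by
    refine closure_minimal (fun y hy => ?_) Metric.isClosed_closedBall
    have : x - y ∈ Function.support (ρ.normed (volume : Measure (EuclideanSpace ℝ (Fin N)))) := hy
    rw [ρ.support_normed_eq, mem_ball_zero_iff] at this
    rw [Metric.mem_closedBall, dist_comm, dist_eq_norm]
    exact this.le
  have hηc : HasCompactSupport η :=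
    HasCompactSupport.of_support_subset_isCompact (isCompact_closedBall x ρ.rOut)
      ((subset_tsupport η).trans hηt)
  have hηd : ∀ y, fderiv ℝ η y e = -fderiv ℝ (ρ.normed volume) (x - y) e := by
    intro y
    have h1 : HasFDerivAt η ((fderiv ℝ (ρ.normed volume) (x - y)).comp
        (-ContinuousLinearMap.id ℝ (EuclideanSpace ℝ (Fin N)))) y :=
      ((hρ.differentiable (by simp)) (x - y)).hasFDerivAt.comp y
        ((hasFDerivAt_id y).const_sub x)
    rw [h1.fderiv]
    simp
  have key := hv.integral_mul_fderiv hηs hηc (hηt.trans hx) e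
  have hL : (fderiv ℝ (ρ.normed volume) ⋆[(lsmul ℝ ℝ).precompL (EuclideanSpace ℝ (Fin N)), volume]
      Ω.indicator v) x e = ∫ y, fderiv ℝ (ρ.normed volume) (x - y) e * Ω.indicator v y := by
    have hex : ConvolutionExistsAt (fderiv ℝ (ρ.normed volume)) (Ω.indicator v) x
        ((lsmul ℝ ℝ).precompL (EuclideanSpace ℝ (Fin N))) volume :=
      (ρ.hasCompactSupport_normed.fderiv (𝕜 := ℝ)).convolutionExists_left _
        (hρ.continuous_fderiv (by simp)) hvi.locallyIntegrable x
    rw [convolution_def, ContinuousLinearMap.integral_apply hex,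
      ← integral_sub_left_eq_self _ volume x]
    refine integral_congr_ae (Eventually.of_forall fun y => ?_)
    simp [precompL_apply]
  have hR : inner ℝ ((ρ.normed volume ⋆[lsmul ℝ ℝ] Ω.indicator g) x) e =
      ∫ y, η y * inner ℝ (Ω.indicator g y) e := by
    have hex : ConvolutionExistsAt (ρ.normed volume) (Ω.indicator g) x
        (lsmul ℝ ℝ) volume :=
      ρ.hasCompactSupport_normed.convolutionExists_left _
        ρ.continuous_normed hgi.locallyIntegrable x
    rw [real_inner_comm, convolution_def, ← integral_inner hex,
      ← integral_sub_left_eq_self _ volume x]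
    refine integral_congr_ae (Eventually.of_forall fun y => ?_)
    simp [hη, real_inner_smul_right, real_inner_comm]
  rw [hL, hR]
  rw [← integral_indicator hΩ.measurableSet, ← integral_indicator hΩ.measurableSet,
    ← integral_neg] at key
  have k1 : ∫ y, fderiv ℝ (ρ.normed volume) (x - y) e * Ω.indicator v y =
      -∫ y, Ω.indicator (fun y => v y * fderiv ℝ η y e) y := by
    rw [← integral_neg]
    refine integral_congr_ae (Eventually.of_forall fun y => ?_)
    by_cases hy : y ∈ Ω
    · simp [hy, hηd, mul_comm]
    · simp [hy]
  rw [k1, key, integral_neg, neg_neg]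
  refine integral_congr_ae (Eventually.of_forall fun y => ?_)
  by_cases hy : y ∈ Ω <;> simp [hy]

/-- Local approximation of a Sobolev function by smooth functions (Friedrichs). -/
theorem MemSobolev.exists_contDiff_approx {Ω : Set (EuclideanSpace ℝ (Fin N))}
    (hΩ : IsOpen Ω)
    {v : EuclideanSpace ℝ (Fin N) → ℝ} {g : EuclideanSpace ℝ (Fin N) → EuclideanSpace ℝ (Fin N)}
    (hv : MemSobolev 1 Ω v g) {K : Set (EuclideanSpace ℝ (Fin N))} (hK : IsCompact K)
    (hKΩ : K ⊆ Ω) {ε : ℝ≥0∞} (hε : ε ≠ 0) :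
    ∃ φ : EuclideanSpace ℝ (Fin N) → ℝ, ContDiff ℝ ∞ φ ∧
      ∫⁻ x in K, ‖φ x - v x‖ₑ ≤ ε ∧ ∫⁻ x in K, ‖gradient φ x - g x‖ₑ ≤ ε := by
  have hvi : Integrable (Ω.indicator v) volume :=
    (integrable_indicator_iff hΩ.measurableSet).2 (memLp_one_iff_integrable.1 hv.memLp)
  have hgi : Integrable (Ω.indicator g) volume :=
    (integrable_indicator_iff hΩ.measurableSet).2 (memLp_one_iff_integrable.1 hv.memLp_grad)
  obtain ⟨δ₁, hδ₁, h₁⟩ := exists_normed_convolution_sub_le hvi hε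
  obtain ⟨δ₂, hδ₂, h₂⟩ := exists_normed_convolution_sub_le hgi hε
  obtain ⟨δ₃, hδ₃, h₃⟩ := hK.exists_cthickening_subset_open hΩ hKΩ
  set δ := min δ₁ (min δ₂ δ₃)
  have hδ0 : 0 < δ := by positivity
  let ρ : ContDiffBump (0 : EuclideanSpace ℝ (Fin N)) := ⟨δ / 2, δ, by positivity, by linarith⟩
  have hρ1 : ρ.rOut ≤ δ₁ := min_le_left _ _
  have hρ2 : ρ.rOut ≤ δ₂ := (min_le_right _ _).trans (min_le_left _ _)
  have hρ3 : ρ.rOut ≤ δ₃ := (min_le_right _ _).trans (min_le_right _ _)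
  refine ⟨ρ.normed volume ⋆[lsmul ℝ ℝ] Ω.indicator v,
    ρ.hasCompactSupport_normed.contDiff_convolution_left _ ρ.contDiff_normed
      hvi.locallyIntegrable, ?_, ?_⟩
  · refine le_trans (le_of_eq ?_) ((setLIntegral_le_lintegral K _).trans (h₁ ρ hρ1))
    refine setLIntegral_congr_fun hK.measurableSet fun x hx => ?_
    simp only [indicator_of_mem (hKΩ hx)]
  · refine le_trans (le_of_eq ?_) ((setLIntegral_le_lintegral K _).trans (h₂ ρ hρ2))
    refine setLIntegral_congr_fun hK.measurableSet fun x hx => ?_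
    have hball : Metric.closedBall x ρ.rOut ⊆ Ω :=
      ((Metric.closedBall_subset_closedBall hρ3).trans
        (Metric.closedBall_subset_cthickening hx δ₃)).trans h₃
    simp only [indicator_of_mem (hKΩ hx), hv.gradient_normed_convolution hΩ ρ hball]

end Mollification

/-! ### The chain rule -/

section ChainRule

open Filter Topology

variable {N : ℕ}

theorem tendsto_inv_natCast_add_one :
    Tendsto (fun n : ℕ => ((n : ℝ≥0∞) + 1)⁻¹) atTop (𝓝 0) := by
  have := (tendsto_add_atTop_iff_nat 1).2 ENNReal.tendsto_inv_nat_nhds_zero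
  simpa using this

theorem MemSobolev.exists_seq_contDiff_tendsto {Ω : Set (EuclideanSpace ℝ (Fin N))}
    (hΩ : IsOpen Ω)
    {v : EuclideanSpace ℝ (Fin N) → ℝ} {g : EuclideanSpace ℝ (Fin N) → EuclideanSpace ℝ (Fin N)}
    (hv : MemSobolev 1 Ω v g) {K : Set (EuclideanSpace ℝ (Fin N))} (hK : IsCompact K)
    (hKΩ : K ⊆ Ω) :
    ∃ φ : ℕ → EuclideanSpace ℝ (Fin N) → ℝ, (∀ n, ContDiff ℝ ∞ (φ n)) ∧
      Tendsto (fun n => ∫⁻ x in K, ‖φ n x - v x‖ₑ) atTop (𝓝 0) ∧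
      Tendsto (fun n => ∫⁻ x in K, ‖gradient (φ n) x - g x‖ₑ) atTop (𝓝 0) ∧
      ∀ᵐ x ∂volume.restrict K, Tendsto (fun n => φ n x) atTop (𝓝 (v x)) := by
  have h := fun n : ℕ => hv.exists_contDiff_approx hΩ hK hKΩ
    (ε := ((n : ℝ≥0∞) + 1)⁻¹) (by simp)
  choose φ hφ h1 h2 using h
  have h0 := tendsto_inv_natCast_add_one
  have t1 : Tendsto (fun n => ∫⁻ x in K, ‖φ n x - v x‖ₑ) atTop (𝓝 0) :=
    tendsto_of_tendsto_of_tendsto_of_le_of_le tendsto_const_nhds h0 (fun _ => zero_le) h1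
  have t2 : Tendsto (fun n => ∫⁻ x in K, ‖gradient (φ n) x - g x‖ₑ) atTop (𝓝 0) :=
    tendsto_of_tendsto_of_tendsto_of_le_of_le tendsto_const_nhds h0 (fun _ => zero_le) h2
  have hvm : AEStronglyMeasurable v (volume.restrict K) :=
    hv.memLp.aestronglyMeasurable.mono_measure (Measure.restrict_mono hKΩ le_rfl)
  obtain ⟨ns, hns, hae⟩ := (tendstoInMeasure_of_tendsto_eLpNorm (p := 1) one_ne_zero
    (fun n => (hφ n).continuous.aestronglyMeasurable) hvm
    (by simpa [eLpNorm_one_eq_lintegral_enorm] using t1)).exists_seq_tendsto_ae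
  exact ⟨fun n => φ (ns n), fun n => hφ _, t1.comp hns.tendsto_atTop, t2.comp hns.tendsto_atTop,
    hae⟩

theorem abs_sub_le_of_deriv_bound {G G' : ℝ → ℝ} {C : ℝ} (hG : ∀ s, HasDerivAt G (G' s) s)
    (hC : ∀ s, |G' s| ≤ C) (s t : ℝ) : |G s - G t| ≤ C * |s - t| := by
  have := Convex.norm_image_sub_le_of_norm_hasDerivWithin_le (f := G) (f' := G') (C := C)
    (fun x _ => (hG x).hasDerivWithinAt) (fun x _ => hC x) convex_univ (mem_univ t) (mem_univ s)
  simpa using this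

/-- Integration by parts against `G ∘ w` for smooth `w`. -/
theorem integral_smul_gradient_comp {G G' : ℝ → ℝ} (hG : ∀ s, HasDerivAt G (G' s) s)
    (hGc : Continuous G') {w φ : EuclideanSpace ℝ (Fin N) → ℝ} (hw : ContDiff ℝ ∞ w)
    (hφ : ContDiff ℝ ∞ φ) (hc : HasCompactSupport φ) :
    ∫ x in tsupport φ, G (w x) • gradient φ x =
      -∫ x in tsupport φ, φ x • (G' (w x) • gradient w x) := by
  have hφ'c : Continuous (fderiv ℝ φ) := hφ.continuous_fderiv (by simp)
  have hw'c : Continuous (fderiv ℝ w) := hw.continuous_fderiv (by simp)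
  have hGcont : Continuous G := continuous_iff_continuousAt.2 fun s => (hG s).continuousAt
  have hd : ∀ x, HasFDerivAt (fun x => G (w x)) (G' (w x) • fderiv ℝ w x) x := fun x =>
    (hG (w x)).comp_hasFDerivAt x ((hw.differentiable (by simp)) x).hasFDerivAt
  have hφ0 : ∀ x, x ∉ tsupport φ → φ x = 0 := fun x hx => image_eq_zero_of_notMem_tsupport hx
  have hφ'0 : ∀ x, x ∉ tsupport φ → fderiv ℝ φ x = 0 := fun x hx =>
    image_eq_zero_of_notMem_tsupport fun h => hx (tsupport_fderiv_subset ℝ h)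
  rw [setIntegral_eq_integral_of_forall_compl_eq_zero
      (fun x hx => by rw [gradient, hφ'0 x hx, map_zero, smul_zero]),
    setIntegral_eq_integral_of_forall_compl_eq_zero
      (fun x hx => by rw [hφ0 x hx, zero_smul])]
  have hi1 : Integrable (fun x => G (w x) • gradient φ x) := by
    refine ((hGcont.comp hw.continuous).smul
      (continuous_gradient_of_contDiff hφ)).integrable_of_hasCompactSupport ?_
    exact HasCompactSupport.intro hc fun x hx => by simp [gradient, hφ'0 x hx]
  have hi2 : Integrable (fun x => φ x • (G' (w x) • gradient w x)) := by
    refine (hφ.continuous.smul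
      ((hGc.comp hw.continuous).smul
        (continuous_gradient_of_contDiff hw))).integrable_of_hasCompactSupport ?_
    exact HasCompactSupport.intro hc fun x hx => by simp [hφ0 x hx]
  refine ext_inner_left ℝ fun e => ?_
  rw [inner_neg_right, ← integral_inner hi1, ← integral_inner hi2]
  simp only [real_inner_comm _ e]
  simp only [real_inner_smul_left, inner_gradient_eq_fderiv]
  have key := integral_mul_fderiv_eq_neg_fderiv_mul_of_integrable (μ := volume) (v := e)
    (f := fun x => G (w x)) (g := φ) ?_ ?_ ?_ (fun x _ => (hd x).differentiableAt)
    (fun x _ => (hφ.differentiable (by simp)) x)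
  · rw [key]
    congr 1
    refine integral_congr_ae (Eventually.of_forall fun x => ?_)
    simp only [(hd x).fderiv, smul_apply, smul_eq_mul]
    ring
  · refine Continuous.integrable_of_hasCompactSupport ?_
      (HasCompactSupport.intro hc fun x hx => by rw [hφ0 x hx, mul_zero])
    simp only [(hd _).fderiv]
    exact (((hGc.comp hw.continuous).smul hw'c).clm_apply continuous_const).mul hφ.continuous
  · refine Continuous.integrable_of_hasCompactSupport ?_
      (HasCompactSupport.intro hc fun x hx => by rw [hφ'0 x hx]; simp)
    exact (hGcont.comp hw.continuous).mul (hφ'c.clm_apply continuous_const)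
  · refine Continuous.integrable_of_hasCompactSupport ?_
      (HasCompactSupport.intro hc fun x hx => by rw [hφ0 x hx, mul_zero])
    exact (hGcont.comp hw.continuous).mul hφ.continuous

/-- The chain rule for a Sobolev function and a `C¹` function with bounded derivative. -/
theorem MemSobolev.comp_weak_grad {Ω : Set (EuclideanSpace ℝ (Fin N))}
    (hΩ : IsOpen Ω)
    {v : EuclideanSpace ℝ (Fin N) → ℝ} {g : EuclideanSpace ℝ (Fin N) → EuclideanSpace ℝ (Fin N)}
    (hv : MemSobolev 1 Ω v g) {G G' : ℝ → ℝ} {C : ℝ} (hG : ∀ s, HasDerivAt G (G' s) s)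
    (hGc : Continuous G') (hC : ∀ s, |G' s| ≤ C)
    {φ : EuclideanSpace ℝ (Fin N) → ℝ} (hφ : ContDiff ℝ ∞ φ)
    (hc : HasCompactSupport φ) (hs : tsupport φ ⊆ Ω) :
    ∫ x in Ω, G (v x) • gradient φ x = -∫ x in Ω, φ x • (G' (v x) • g x) := by
  set K := tsupport φ
  have hK : IsCompact K := hc
  have : IsFiniteMeasure (volume.restrict K) := ⟨by
    rw [Measure.restrict_apply_univ]; exact hK.measure_lt_top⟩
  have hle : volume.restrict K ≤ volume.restrict Ω := Measure.restrict_mono hs le_rfl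
  have hvi : Integrable v (volume.restrict K) :=
    (memLp_one_iff_integrable.1 hv.memLp).mono_measure hle
  have hgi : Integrable g (volume.restrict K) :=
    (memLp_one_iff_integrable.1 hv.memLp_grad).mono_measure hle
  have hC0 : 0 ≤ C := (abs_nonneg _).trans (hC 0)
  have hGcont : Continuous G := continuous_iff_continuousAt.2 fun s => (hG s).continuousAt
  obtain ⟨A, hA⟩ := hc.exists_bound_of_continuous hφ.continuous
  have hφ'c : Continuous (fderiv ℝ φ) := hφ.continuous_fderiv (by simp)
  obtain ⟨B, hB⟩ := (hc.fderiv (𝕜 := ℝ)).exists_bound_of_continuous hφ'c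
  have hgradB : ∀ x, ‖gradient φ x‖ ≤ B := fun x => by simpa [gradient] using hB x
  have hgradc : Continuous (gradient φ) :=
    continuous_gradient_of_contDiff hφ
  have hφ0 : ∀ x, x ∉ K → φ x = 0 := fun x hx => image_eq_zero_of_notMem_tsupport hx
  have hφ'0 : ∀ x, x ∉ K → fderiv ℝ φ x = 0 := fun x hx =>
    image_eq_zero_of_notMem_tsupport fun h => hx (tsupport_fderiv_subset ℝ h)
  have hgrad0 : ∀ x, x ∉ K → gradient φ x = 0 := fun x hx => by simp [gradient, hφ'0 x hx]
  have hGv : Integrable (fun x => G (v x)) (volume.restrict K) := by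
    refine Integrable.mono' ((integrable_const |G 0|).add (hvi.norm.const_mul C))
      (hGcont.comp_aestronglyMeasurable hvi.aestronglyMeasurable)
      (Eventually.of_forall fun x => ?_)
    have := abs_sub_le_of_deriv_bound hG hC (v x) 0
    rw [sub_zero] at this
    rw [Real.norm_eq_abs, Pi.add_apply, Real.norm_eq_abs]
    have h2 := abs_add_le (G (v x) - G 0) (G 0)
    rw [sub_add_cancel] at h2
    linarith
  rw [setIntegral_eq_of_subset_of_forall_sdiff_eq_zero hΩ.measurableSet hs
      (fun x hx => by rw [hgrad0 x hx.2, smul_zero]),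
    setIntegral_eq_of_subset_of_forall_sdiff_eq_zero hΩ.measurableSet hs
      (fun x hx => by rw [hφ0 x hx.2, zero_smul])]
  obtain ⟨w, hw, hw1, hw2, hwae⟩ := hv.exists_seq_contDiff_tendsto hΩ hK hs
  have hwgc : ∀ n, Continuous (gradient (w n)) := fun n =>
    continuous_gradient_of_contDiff (hw n)
  have hbdd : ∀ (n : ℕ) {F : EuclideanSpace ℝ (Fin N) → EuclideanSpace ℝ (Fin N)},
      Integrable F (volume.restrict K) →
      Integrable (fun x => φ x • (G' (w n x) • F x)) (volume.restrict K) := fun n F hF =>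
    (hF.bdd_smul C (hGc.comp (hw n).continuous).aestronglyMeasurable
      (Eventually.of_forall fun x => hC _)).bdd_smul A hφ.continuous.aestronglyMeasurable
      (Eventually.of_forall hA)
  have hident : ∀ n, ∫ x in K, G (w n x) • gradient φ x =
      -∫ x in K, φ x • (G' (w n x) • gradient (w n) x) :=
    fun n => integral_smul_gradient_comp hG hGc (hw n) hφ hc
  have hlim1 : Tendsto (fun n => ∫ x in K, G (w n x) • gradient φ x) atTop
      (𝓝 (∫ x in K, G (v x) • gradient φ x)) := by
    refine tendsto_integral_of_L1 _
      (hGv.aestronglyMeasurable.smul hgradc.aestronglyMeasurable)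
      (Eventually.of_forall fun n =>
        ((hGcont.comp (hw n).continuous).smul hgradc).continuousOn.integrableOn_compact hK) ?_
    have hb : ∀ n, ∫⁻ x in K, ‖G (w n x) • gradient φ x - G (v x) • gradient φ x‖ₑ ≤
        ENNReal.ofReal (C * B) * ∫⁻ x in K, ‖w n x - v x‖ₑ := by
      intro n
      rw [← lintegral_const_mul' _ _ ENNReal.ofReal_ne_top]
      refine lintegral_mono fun x => ?_
      rw [← sub_smul, enorm_smul, ← ofReal_norm, ← ofReal_norm, ← ofReal_norm,
        ← ENNReal.ofReal_mul (norm_nonneg _),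
        ← ENNReal.ofReal_mul (mul_nonneg hC0 ((norm_nonneg _).trans (hgradB x)))]
      refine ENNReal.ofReal_le_ofReal ?_
      have := abs_sub_le_of_deriv_bound hG hC (w n x) (v x)
      simp only [Real.norm_eq_abs]
      calc _ ≤ (C * |w n x - v x|) * B :=
            mul_le_mul this (hgradB x) (norm_nonneg _) (by positivity)
        _ = _ := by ring
    refine tendsto_of_tendsto_of_tendsto_of_le_of_le tendsto_const_nhds ?_ (fun _ => zero_le) hb
    simpa using ENNReal.Tendsto.const_mul (a := ENNReal.ofReal (C * B)) hw1
      (Or.inr ENNReal.ofReal_ne_top)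
  have hlim2 : Tendsto (fun n => ∫ x in K, φ x • (G' (w n x) • (gradient (w n) x - g x))) atTop
      (𝓝 0) := by
    have h0 : (0 : EuclideanSpace ℝ (Fin N)) = ∫ x in K, (0 : EuclideanSpace ℝ (Fin N)) := by simp
    rw [h0]
    have hA0 : 0 ≤ A := (norm_nonneg _).trans (hA 0)
    refine tendsto_integral_of_L1 _ aestronglyMeasurable_const
      (Eventually.of_forall fun n => ?_) ?_
    · exact hbdd n (((hwgc n).continuousOn.integrableOn_compact hK).sub hgi)
    have hb : ∀ n, ∫⁻ x in K, ‖φ x • (G' (w n x) • (gradient (w n) x - g x)) - 0‖ₑ ≤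
        ENNReal.ofReal (A * C) * ∫⁻ x in K, ‖gradient (w n) x - g x‖ₑ := by
      intro n
      rw [← lintegral_const_mul' _ _ ENNReal.ofReal_ne_top]
      refine lintegral_mono fun x => ?_
      rw [sub_zero, enorm_smul, enorm_smul, ← ofReal_norm, ← ofReal_norm, ← mul_assoc,
        ← ENNReal.ofReal_mul (norm_nonneg _)]
      gcongr
      · exact hA x
      · exact hC _
    refine tendsto_of_tendsto_of_tendsto_of_le_of_le tendsto_const_nhds ?_ (fun _ => zero_le) hb
    simpa using ENNReal.Tendsto.const_mul (a := ENNReal.ofReal (A * C)) hw2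
      (Or.inr ENNReal.ofReal_ne_top)
  have hlim3 : Tendsto (fun n => ∫ x in K, φ x • (G' (w n x) • g x)) atTop
      (𝓝 (∫ x in K, φ x • (G' (v x) • g x))) := by
    refine tendsto_integral_of_dominated_convergence (fun x => A * (C * ‖g x‖))
      (fun n => hφ.continuous.aestronglyMeasurable.smul
        ((hGc.comp (hw n).continuous).aestronglyMeasurable.smul hgi.aestronglyMeasurable))
      ((hgi.norm.const_mul C).const_mul A)
      (fun n => Eventually.of_forall fun x => ?_) ?_
    · rw [norm_smul, norm_smul]
      gcongr
      · exact (norm_nonneg _).trans (hA x)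
      · exact hA x
      · exact hC _
    · filter_upwards [hwae] with x hx
      exact ((((hGc.tendsto _).comp hx).smul_const _).const_smul _)
  have hlim4 : Tendsto (fun n => ∫ x in K, φ x • (G' (w n x) • gradient (w n) x)) atTop
      (𝓝 (∫ x in K, φ x • (G' (v x) • g x))) := by
    have := hlim2.add hlim3
    rw [zero_add] at this
    refine this.congr fun n => ?_
    rw [← integral_add]
    · refine integral_congr_ae (Eventually.of_forall fun x => ?_)
      simp only [smul_sub, sub_add_cancel]
    · exact hbdd n (((hwgc n).continuousOn.integrableOn_compact hK).sub hgi)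
    · exact hbdd n hgi
  exact tendsto_nhds_unique hlim1 (hlim4.neg.congr fun n => (hident n).symm)

end ChainRule

/-! ### Polar coordinates -/

section Polar

open Filter Topology

variable {N : ℕ}

/-- Integration in polar coordinates centred at `P`. -/
theorem lintegral_polar (hN : 1 ≤ N) (P : EuclideanSpace ℝ (Fin N))
    {F : EuclideanSpace ℝ (Fin N) → ℝ≥0∞} (hF : Measurable F) :
    ∫⁻ x, F x = ∫⁻ θ : Metric.sphere (0 : EuclideanSpace ℝ (Fin N)) 1,
      (∫⁻ r in Ioi (0 : ℝ), ENNReal.ofReal (r ^ (N - 1)) *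
        F (P + r • (θ : EuclideanSpace ℝ (Fin N))))
        ∂(volume : Measure (EuclideanSpace ℝ (Fin N))).toSphere := by
  have : Nontrivial (EuclideanSpace ℝ (Fin N)) := by
    have : Nonempty (Fin N) := ⟨⟨0, hN⟩⟩
    infer_instance
  have hFP : Measurable fun x => F (P + x) := hF.comp (measurable_const_add P)
  have hmp :=
    (volume : Measure (EuclideanSpace ℝ (Fin N))).measurePreserving_homeomorphUnitSphereProd
  have hfin : Module.finrank ℝ (EuclideanSpace ℝ (Fin N)) = N := by simp
  rw [hfin] at hmp
  have hG : Measurable fun p : Metric.sphere (0 : EuclideanSpace ℝ (Fin N)) 1 × Ioi (0 : ℝ) =>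
      F (P + (p.2 : ℝ) • (p.1 : EuclideanSpace ℝ (Fin N))) :=
    hFP.comp ((measurable_subtype_coe.comp measurable_snd).smul
      (measurable_subtype_coe.comp measurable_fst))
  calc ∫⁻ x, F x = ∫⁻ x, F (P + x) := (lintegral_add_left_eq_self F P).symm
    _ = ∫⁻ x in ({0}ᶜ : Set (EuclideanSpace ℝ (Fin N))), F (P + x) := by
        rw [restrict_compl_singleton]
    _ = ∫⁻ x : ({0}ᶜ : Set (EuclideanSpace ℝ (Fin N))), F (P + x)
          ∂(volume.comap Subtype.val) :=
        (lintegral_subtype_comap (measurableSet_singleton _).compl _).symm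
    _ = ∫⁻ x : ({0}ᶜ : Set (EuclideanSpace ℝ (Fin N))),
          (fun p : Metric.sphere (0 : EuclideanSpace ℝ (Fin N)) 1 × Ioi (0 : ℝ) =>
            F (P + (p.2 : ℝ) • (p.1 : EuclideanSpace ℝ (Fin N))))
              (homeomorphUnitSphereProd (EuclideanSpace ℝ (Fin N)) x)
          ∂(volume.comap Subtype.val) := by
        refine lintegral_congr fun x => ?_
        have hx : ‖(x : EuclideanSpace ℝ (Fin N))‖ ≠ 0 := norm_ne_zero_iff.2 x.2
        simp [smul_smul, mul_inv_cancel₀ hx]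
    _ = ∫⁻ p, F (P + (p.2 : ℝ) • (p.1 : EuclideanSpace ℝ (Fin N)))
          ∂((volume : Measure (EuclideanSpace ℝ (Fin N))).toSphere.prod
            (Measure.volumeIoiPow (N - 1))) := hmp.lintegral_comp hG
    _ = _ := by
        rw [lintegral_prod _ hG.aemeasurable]
        refine lintegral_congr fun θ => ?_
        rw [Measure.volumeIoiPow, lintegral_withDensity_eq_lintegral_mul _ (by fun_prop)
          (g := fun r : Ioi (0 : ℝ) => F (P + (r : ℝ) • (θ : EuclideanSpace ℝ (Fin N))))
          (hG.comp measurable_prodMk_left)]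
        exact lintegral_subtype_comap measurableSet_Ioi
          (fun r : ℝ => ENNReal.ofReal (r ^ (N - 1)) *
            F (P + r • (θ : EuclideanSpace ℝ (Fin N))))

theorem ae_sphere_of_lintegral_ne_top (hN : 1 ≤ N) (P : EuclideanSpace ℝ (Fin N))
    {F : EuclideanSpace ℝ (Fin N) → ℝ≥0∞} (hF : Measurable F) (hfin : ∫⁻ x, F x ≠ ⊤) :
    ∀ᵐ θ : Metric.sphere (0 : EuclideanSpace ℝ (Fin N)) 1
        ∂(volume : Measure (EuclideanSpace ℝ (Fin N))).toSphere,
      ∫⁻ r in Ioi (0 : ℝ), ENNReal.ofReal (r ^ (N - 1)) *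
        F (P + r • (θ : EuclideanSpace ℝ (Fin N))) ≠ ⊤ := by
  rw [lintegral_polar hN P hF] at hfin
  have hm : Measurable fun θ : Metric.sphere (0 : EuclideanSpace ℝ (Fin N)) 1 =>
      ∫⁻ r in Ioi (0 : ℝ), ENNReal.ofReal (r ^ (N - 1)) *
        F (P + r • (θ : EuclideanSpace ℝ (Fin N))) := by
    refine Measurable.lintegral_prod_right' (f := fun p :
      Metric.sphere (0 : EuclideanSpace ℝ (Fin N)) 1 × ℝ => ENNReal.ofReal (p.2 ^ (N - 1)) *
        F (P + p.2 • (p.1 : EuclideanSpace ℝ (Fin N)))) ?_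
    refine Measurable.mul (by fun_prop) (hF.comp ?_)
    exact (measurable_snd.smul (measurable_subtype_coe.comp measurable_fst)).const_add P
  filter_upwards [ae_lt_top hm hfin] with θ hθ using hθ.ne

/-- A null set meets almost every ray in a null set. -/
theorem ae_sphere_ae_ray (hN : 1 ≤ N) (P : EuclideanSpace ℝ (Fin N))
    {p : EuclideanSpace ℝ (Fin N) → Prop} (hp : ∀ᵐ x, p x) :
    ∀ᵐ θ : Metric.sphere (0 : EuclideanSpace ℝ (Fin N)) 1
        ∂(volume : Measure (EuclideanSpace ℝ (Fin N))).toSphere,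
      ∀ᵐ r ∂volume.restrict (Ioi (0 : ℝ)), p (P + r • (θ : EuclideanSpace ℝ (Fin N))) := by
  set s := toMeasurable volume {x | ¬ p x} with hs
  have hsm : MeasurableSet s := measurableSet_toMeasurable _ _
  have hs0 : volume s = 0 := by rw [hs, measure_toMeasurable]; exact hp
  have hF : Measurable (s.indicator fun _ => (⊤ : ℝ≥0∞)) := measurable_const.indicator hsm
  have h0 : ∫⁻ x, s.indicator (fun _ => (⊤ : ℝ≥0∞)) x ≠ ⊤ := by
    rw [lintegral_indicator_const hsm, hs0]; simp
  filter_upwards [ae_sphere_of_lintegral_ne_top hN P hF h0] with θ hθ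
  have hm : Measurable fun r : ℝ => ENNReal.ofReal (r ^ (N - 1)) *
      s.indicator (fun _ => (⊤ : ℝ≥0∞)) (P + r • (θ : EuclideanSpace ℝ (Fin N))) :=
    Measurable.mul (by fun_prop) (hF.comp (by fun_prop))
  filter_upwards [ae_lt_top hm hθ, ae_restrict_mem measurableSet_Ioi] with r hr hr0
  by_contra hnp
  have hmem : P + r • (θ : EuclideanSpace ℝ (Fin N)) ∈ s := subset_toMeasurable _ _ hnp
  rw [indicator_of_mem hmem, ENNReal.mul_top] at hr
  · exact lt_irrefl _ hr
  · exact (ENNReal.ofReal_pos.2 (pow_pos hr0 _)).ne'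

end Polar

/-! ### One-dimensional estimates -/

section OneDim

open Filter Topology

/-- The fundamental theorem of calculus in the limit. -/
theorem enorm_le_add_lintegral_of_tendsto {p p' : ℕ → ℝ → ℝ} {v : ℝ → ℝ} {q : ℝ → ℝ≥0∞}
    {e : ℕ → ℝ → ℝ≥0∞} {r s : ℝ} (hrs : r ≤ s)
    (hp : ∀ n τ, HasDerivAt (p n) (p' n τ) τ) (hp' : ∀ n, Continuous (p' n))
    (hr : Tendsto (fun n => p n r) atTop (𝓝 (v r)))
    (hs : Tendsto (fun n => p n s) atTop (𝓝 (v s))) (he : ∀ n, Measurable (e n))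
    (hq : ∀ n τ, ‖p' n τ‖ₑ ≤ q τ + e n τ)
    (he0 : Tendsto (fun n => ∫⁻ τ in Ioc r s, e n τ) atTop (𝓝 0)) :
    ‖v r‖ₑ ≤ ‖v s‖ₑ + ∫⁻ τ in Ioc r s, q τ := by
  have h1 : ∀ n, ‖p n r‖ₑ ≤ ‖p n s‖ₑ + ((∫⁻ τ in Ioc r s, q τ) + ∫⁻ τ in Ioc r s, e n τ) := by
    intro n
    have hftc : ∫ τ in r..s, p' n τ = p n s - p n r :=
      intervalIntegral.integral_eq_sub_of_hasDerivAt (fun τ _ => hp n τ)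
        ((hp' n).intervalIntegrable _ _)
    have e1 : p n r = p n s - ∫ τ in r..s, p' n τ := by rw [hftc]; ring
    rw [e1, intervalIntegral.integral_of_le hrs]
    refine (enorm_sub_le).trans ?_
    refine add_le_add le_rfl ((enorm_integral_le_lintegral_enorm _).trans ?_)
    rw [← lintegral_add_right _ (he n)]
    exact lintegral_mono fun τ => hq n τ
  have t1 : Tendsto (fun n => ‖p n r‖ₑ) atTop (𝓝 ‖v r‖ₑ) := hr.enorm
  have t2 := hs.enorm.add ((tendsto_const_nhds (x := ∫⁻ τ in Ioc r s, q τ)).add he0)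
  rw [add_zero] at t2
  exact le_of_tendsto_of_tendsto' t1 t2 h1

end OneDim

/-! ### Ray sections and Sobolev functions on rays -/

section Rays

open Filter Topology

variable {N : ℕ} {Ω : Set (EuclideanSpace ℝ (Fin N))} {P : EuclideanSpace ℝ (Fin N)}

theorem norm_eq_one_of_mem_crossSection {θ : EuclideanSpace ℝ (Fin N)}
    (hθ : θ ∈ crossSection Ω P) : ‖θ‖ = 1 := by
  obtain ⟨x, -, hx, rfl⟩ := hθ
  have : ‖x - P‖ ≠ 0 := norm_ne_zero_iff.2 (sub_ne_zero.2 hx)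
  rw [norm_smul, norm_inv, norm_norm, inv_mul_cancel₀ this]

theorem mem_crossSection_of_ray {θ : EuclideanSpace ℝ (Fin N)} (hθ : ‖θ‖ = 1) {r : ℝ}
    (hr : 0 < r) (h : P + r • θ ∈ Ω) : θ ∈ crossSection Ω P := by
  refine ⟨P + r • θ, h, ?_, ?_⟩
  · intro h0
    rw [add_eq_left, smul_eq_zero] at h0
    rcases h0 with h0 | h0
    · exact hr.ne' h0
    · rw [h0, norm_zero] at hθ
      exact zero_ne_one hθ
  · rw [add_sub_cancel_left, norm_smul, hθ, mul_one, Real.norm_of_nonneg hr.le, smul_smul,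
      inv_mul_cancel₀ hr.ne', one_smul]

namespace IsRaySection

variable {θ : EuclideanSpace ℝ (Fin N)} {K : ℕ} {lo hi : Fin K → ℝ}

theorem disjoint (h : IsRaySection Ω P θ lo hi) {j k : Fin K} (hjk : j ≠ k) :
    Disjoint (Ioo (lo j) (hi j)) (Ioo (lo k) (hi k)) := by
  rw [Set.disjoint_left]
  intro r hj hk
  rcases lt_or_gt_of_ne hjk with hlt | hlt
  · exact absurd (h.lt _ _ hlt) (by linarith [hj.2, hk.1])
  · exact absurd (h.lt _ _ hlt) (by linarith [hk.2, hj.1])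

theorem mem_of_mem_Ioo (h : IsRaySection Ω P θ lo hi) {k : Fin K} {r : ℝ}
    (hr : r ∈ Ioo (lo k) (hi k)) : P + r • θ ∈ Ω := by
  have : r ∈ {r : ℝ | 0 < r ∧ P + r • θ ∈ Ω} := by
    rw [h.inside]; exact mem_iUnion.2 ⟨k, hr⟩
  exact this.2

theorem hi_notMem (h : IsRaySection Ω P θ lo hi) {k : Fin K} (hk : lo k < hi k) :
    P + hi k • θ ∉ Ω := by
  intro hmem
  have : hi k ∈ {r : ℝ | 0 < r ∧ P + r • θ ∈ Ω} := ⟨(h.nonneg k).trans_lt hk, hmem⟩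
  rw [h.inside, mem_iUnion] at this
  obtain ⟨j, hj⟩ := this
  rcases lt_trichotomy j k with hlt | rfl | hlt
  · linarith [h.lt _ _ hlt, hj.2]
  · exact lt_irrefl _ hj.2
  · linarith [h.lt _ _ hlt, hj.1]

/-- A radius at which the ray leaves `Ω` is not a lower radius in any description of the ray. -/
theorem hi_ne_lo (h : IsRaySection Ω P θ lo hi) {k : Fin K} (hk : lo k < hi k)
    {K' : ℕ} {lo' hi' : Fin K' → ℝ} (h' : IsRaySection Ω P θ lo' hi') (j : Fin K') :
    hi k ≠ lo' j := by
  intro heq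
  -- Radii slightly below `hi k` lie in `Ω`, hence in an interval `(lo' i, hi' i)` that reaches up to
  -- `hi k`; then `lo' j = hi k` contradicts the order of the intervals.
  have hlt : ∀ᶠ r in 𝓝[<] hi k, ∀ i : Fin K', hi' i < hi k → hi' i < r := by
    rw [eventually_all]
    intro i
    by_cases hik : hi' i < hi k
    · filter_upwards [nhdsWithin_le_nhds (lt_mem_nhds hik)] with r hr using fun _ => hr
    · exact Eventually.of_forall fun r h0 => absurd h0 hik
  obtain ⟨r, hr, hr2⟩ := (hlt.and (Ioo_mem_nhdsLT hk)).exists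
  have hin : r ∈ {r : ℝ | 0 < r ∧ P + r • θ ∈ Ω} :=
    ⟨(h.nonneg k).trans_lt hr2.1, h.mem_of_mem_Ioo hr2⟩
  rw [h'.inside, mem_iUnion] at hin
  obtain ⟨i, hri⟩ := hin
  have h1 : hi k ≤ hi' i := by
    by_contra hcon
    exact absurd (hr i (not_le.1 hcon)) (not_lt.2 hri.2.le)
  rcases lt_trichotomy i j with hij | rfl | hij
  · linarith [h'.lt _ _ hij]
  · linarith [hri.1, hr2.2]
  · linarith [h'.lt _ _ hij, h'.le j, hri.1, hr2.2]

theorem hi_mem_backContactSet (h : IsRaySection Ω P θ lo hi) (hθ : θ ∈ crossSection Ω P)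
    {k : Fin K} (hk : lo k < hi k) : P + hi k • θ ∈ backContactSet Ω P := by
  have hpos : 0 < hi k := (h.nonneg k).trans_lt hk
  refine ⟨⟨?_, hi k, hpos, θ, hθ, rfl⟩, ?_⟩
  · have : hi k ∈ {r : ℝ | 0 ≤ r ∧ P + r • θ ∈ frontier Ω} := by
      rw [h.boundary]
      exact ⟨Or.inr ⟨k, rfl⟩, h.hi_notMem hk⟩
    exact this.2
  · rintro ⟨-, θ', hθ', K', lo', hi', h', j, hj⟩
    have e1 : hi k • θ = lo' j • θ' := add_left_cancel hj
    have e2 : hi k = lo' j := by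
      have := congrArg norm e1
      rwa [norm_smul, norm_smul, norm_eq_one_of_mem_crossSection hθ,
        norm_eq_one_of_mem_crossSection hθ', mul_one, mul_one, Real.norm_of_nonneg hpos.le,
        Real.norm_of_nonneg (h'.nonneg j)] at this
    rw [← e2] at e1
    have e3 : θ = θ' := smul_right_injective _ hpos.ne' e1
    subst e3
    exact h.hi_ne_lo hk h' j e2

end IsRaySection

theorem radialWidth_nonneg : 0 ≤ radialWidth Ω P := by
  refine Real.sSup_nonneg ?_
  rintro t ⟨θ, -, K, lo, hi, h, k, rfl⟩
  exact sub_nonneg.2 (h.le k)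

theorem IsRaySection.sub_le_radialWidth (hΩ : Bornology.IsBounded Ω)
    {θ : EuclideanSpace ℝ (Fin N)} (hθ : θ ∈ crossSection Ω P) {K : ℕ} {lo hi : Fin K → ℝ}
    (h : IsRaySection Ω P θ lo hi) (k : Fin K) : hi k - lo k ≤ radialWidth Ω P := by
  refine le_csSup ?_ ⟨θ, hθ, K, lo, hi, h, k, rfl⟩
  obtain ⟨R, hR⟩ := hΩ.subset_closedBall P
  refine ⟨max R 0, ?_⟩
  rintro t ⟨θ', hθ', K', lo', hi', h', j, rfl⟩
  rcases (h'.le j).eq_or_lt with he | hlt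
  · rw [he, sub_self]; exact le_max_right _ _
  · have h1 : hi' j ≤ R := by
      refine le_of_forall_lt_imp_le_of_dense fun r hr => ?_
      have hs : max r ((lo' j + hi' j) / 2) ∈ Ioo (lo' j) (hi' j) :=
        ⟨lt_max_of_lt_right (by linarith), max_lt hr (by linarith)⟩
      have h2 := hR (h'.mem_of_mem_Ioo hs)
      rw [mem_closedBall_iff_norm, add_sub_cancel_left, norm_smul,
        norm_eq_one_of_mem_crossSection hθ', mul_one] at h2
      exact (le_max_left _ _).trans ((le_abs_self _).trans h2)
    exact (sub_le_self _ (h'.nonneg j)).trans (h1.trans (le_max_left _ _))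

/-- Almost every ray from `P` meets a Sobolev function in a function that is absolutely
continuous, up to a null set of radii, with derivative bounded by the weak gradient. -/
theorem MemSobolev.ae_ray_bound (hN : 1 ≤ N) (hΩ : IsOpen Ω)
    {v : EuclideanSpace ℝ (Fin N) → ℝ} {g : EuclideanSpace ℝ (Fin N) → EuclideanSpace ℝ (Fin N)}
    (hv : MemSobolev 1 Ω v g) (hvm : Measurable v) (hgm : Measurable g)
    (P : EuclideanSpace ℝ (Fin N)) :
    ∀ᵐ θ : Metric.sphere (0 : EuclideanSpace ℝ (Fin N)) 1
        ∂(volume : Measure (EuclideanSpace ℝ (Fin N))).toSphere,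
      ∃ A : Set ℝ, (∀ᵐ r ∂volume.restrict (Ioi (0 : ℝ)),
          P + r • (θ : EuclideanSpace ℝ (Fin N)) ∈ Ω → r ∈ A) ∧
        ∀ r s, 0 < r → r ≤ s → r ∈ A → s ∈ A →
          (∀ τ ∈ Icc r s, P + τ • (θ : EuclideanSpace ℝ (Fin N)) ∈ Ω) →
          ‖v (P + r • (θ : EuclideanSpace ℝ (Fin N)))‖ₑ ≤
            ‖v (P + s • (θ : EuclideanSpace ℝ (Fin N)))‖ₑ +
              ∫⁻ τ in Ioc r s, ‖g (P + τ • (θ : EuclideanSpace ℝ (Fin N)))‖ₑ := by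
  have : LocallyCompactSpace Ω := hΩ.locallyCompactSpace
  let ex : CompactExhaustion Ω := default
  set K : ℕ → Set (EuclideanSpace ℝ (Fin N)) := fun n => Subtype.val '' ex n
  have hKc : ∀ n, IsCompact (K n) := fun n => (ex.isCompact n).image continuous_subtype_val
  have hKm : ∀ n, MeasurableSet (K n) := fun n => (hKc n).measurableSet
  have hKΩ : ∀ n, K n ⊆ Ω := fun n => by rintro _ ⟨x, -, rfl⟩; exact x.2
  have hKex : ∀ C : Set (EuclideanSpace ℝ (Fin N)), IsCompact C → C ⊆ Ω →
      ∃ n₀, ∀ n ≥ n₀, C ⊆ K n := by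
    intro C hC hCΩ
    have h1 : IsCompact (Subtype.val ⁻¹' C : Set Ω) := by
      rw [Subtype.isCompact_iff, Subtype.image_preimage_coe, inter_eq_self_of_subset_right hCΩ]
      exact hC
    obtain ⟨n₀, hn₀⟩ := ex.exists_superset_of_isCompact h1
    refine ⟨n₀, fun n hn x hx => ⟨⟨x, hCΩ hx⟩, ex.subset hn (hn₀ hx), rfl⟩⟩
  have happ := fun n : ℕ => hv.exists_contDiff_approx hΩ (hKc n) (hKΩ n)
    (ε := (1 / 2 : ℝ≥0∞) ^ n) (pow_ne_zero _ (by simp))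
  choose w hw hw1 hw2 using happ
  have hwgc : ∀ n, Continuous (gradient (w n)) := fun n =>
    continuous_gradient_of_contDiff (hw n)
  -- The errors of the approximations are summable over `Ω`, so by Tonelli they are summable on
  -- almost every ray.
  set E : ℕ → EuclideanSpace ℝ (Fin N) → ℝ≥0∞ := fun n => (K n).indicator
    (fun x => ‖w n x - v x‖ₑ + ‖gradient (w n) x - g x‖ₑ) with hE
  have hm1 : ∀ n, Measurable fun x => ‖w n x - v x‖ₑ := fun n =>
    ((hw n).continuous.measurable.sub hvm).enorm
  have hm2 : ∀ n, Measurable fun x => ‖gradient (w n) x - g x‖ₑ := fun n =>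
    ((hwgc n).measurable.sub hgm).enorm
  have hEm : ∀ n, Measurable (E n) := fun n => ((hm1 n).add (hm2 n)).indicator (hKm n)
  have hfin : ∫⁻ x, ∑' n, E n x ≠ ⊤ := by
    rw [lintegral_tsum fun n => (hEm n).aemeasurable]
    have hb : ∀ n, ∫⁻ x, E n x ≤ 2 * (1 / 2 : ℝ≥0∞) ^ n := by
      intro n
      rw [hE, lintegral_indicator (hKm n), lintegral_add_left (hm1 n), two_mul]
      exact add_le_add (hw1 n) (hw2 n)
    refine ((ENNReal.tsum_le_tsum hb).trans_lt ?_).ne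
    rw [ENNReal.tsum_mul_left, ENNReal.tsum_geometric]
    simp [ENNReal.mul_lt_top]
  filter_upwards [ae_sphere_of_lintegral_ne_top hN P (Measurable.tsum hEm) hfin] with θ hθ
  have hray : Measurable fun r : ℝ => P + r • (θ : EuclideanSpace ℝ (Fin N)) := by fun_prop
  refine ⟨{r | Tendsto (fun n => w n (P + r • (θ : EuclideanSpace ℝ (Fin N)))) atTop
    (𝓝 (v (P + r • (θ : EuclideanSpace ℝ (Fin N)))))}, ?_, ?_⟩
  · have hm : Measurable fun r : ℝ => ENNReal.ofReal (r ^ (N - 1)) *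
        ∑' n, E n (P + r • (θ : EuclideanSpace ℝ (Fin N))) :=
      Measurable.mul (by fun_prop) ((Measurable.tsum hEm).comp hray)
    filter_upwards [ae_lt_top hm hθ, ae_restrict_mem measurableSet_Ioi] with r hr hr0 hrΩ
    have hr0 : 0 < r := hr0
    have hs : ∑' n, E n (P + r • (θ : EuclideanSpace ℝ (Fin N))) ≠ ⊤ := by
      intro htop
      rw [htop, ENNReal.mul_top (ENNReal.ofReal_pos.2 (pow_pos hr0 _)).ne'] at hr
      exact lt_irrefl _ hr
    have ht := ENNReal.tendsto_atTop_zero_of_tsum_ne_top hs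
    obtain ⟨n₀, hn₀⟩ := hKex {P + r • (θ : EuclideanSpace ℝ (Fin N))} isCompact_singleton
      (singleton_subset_iff.2 hrΩ)
    rw [tendsto_iff_edist_tendsto_0]
    refine tendsto_of_tendsto_of_tendsto_of_le_of_le' tendsto_const_nhds ht
      (Eventually.of_forall fun _ => zero_le) ?_
    filter_upwards [eventually_ge_atTop n₀] with n hn
    rw [hE]
    simp only [indicator_of_mem (hn₀ n hn rfl), edist_eq_enorm_sub]
    exact le_self_add
  · intro r s hr0 hrs hr hs hseg
    set γ : ℝ → EuclideanSpace ℝ (Fin N) := fun τ => P + τ • (θ : EuclideanSpace ℝ (Fin N))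
    have hγd : ∀ τ, HasDerivAt γ (θ : EuclideanSpace ℝ (Fin N)) τ := fun τ => by
      have := ((hasDerivAt_id τ).smul_const (θ : EuclideanSpace ℝ (Fin N))).const_add P
      rwa [one_smul] at this
    have hγc : Continuous γ := continuous_iff_continuousAt.2 fun τ => (hγd τ).continuousAt
    have hθ1 : ‖(θ : EuclideanSpace ℝ (Fin N))‖ = 1 := by simp
    refine enorm_le_add_lintegral_of_tendsto (p := fun n τ => w n (γ τ))
      (p' := fun n τ => fderiv ℝ (w n) (γ τ) θ) (v := fun τ => v (γ τ))
      (q := fun τ => ‖g (γ τ)‖ₑ) (e := fun n τ => ‖gradient (w n) (γ τ) - g (γ τ)‖ₑ) hrs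
      (fun n τ => ?_) (fun n => ?_) hr hs (fun n => (hm2 n).comp hray) (fun n τ => ?_) ?_
    · exact (((hw n).differentiable (by simp)) (γ τ)).hasFDerivAt.comp_hasDerivAt τ (hγd τ)
    · exact (((hw n).continuous_fderiv (by simp)).comp hγc).clm_apply continuous_const
    · rw [← inner_gradient_eq_fderiv]
      calc ‖inner ℝ (gradient (w n) (γ τ)) (θ : EuclideanSpace ℝ (Fin N))‖ₑ
          ≤ ‖gradient (w n) (γ τ)‖ₑ := by
            rw [← ofReal_norm, ← ofReal_norm]
            refine ENNReal.ofReal_le_ofReal ((norm_inner_le_norm _ _).trans ?_)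
            rw [hθ1, mul_one]
        _ = ‖g (γ τ) + (gradient (w n) (γ τ) - g (γ τ))‖ₑ := by rw [add_sub_cancel]
        _ ≤ _ := enorm_add_le _ _
    · obtain ⟨n₀, hn₀⟩ := hKex (γ '' Icc r s) (isCompact_Icc.image hγc)
        (image_subset_iff.2 hseg)
      have hsum : ∑' n, ∫⁻ τ in Ioi (0 : ℝ), ENNReal.ofReal (τ ^ (N - 1)) * E n (γ τ) ≠ ⊤ := by
        have hm : ∀ n, Measurable fun τ : ℝ => ENNReal.ofReal (τ ^ (N - 1)) * E n (γ τ) :=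
          fun n => Measurable.mul (by fun_prop) ((hEm n).comp hray)
        rw [← lintegral_tsum fun n => (hm n).aemeasurable]
        simpa only [ENNReal.tsum_mul_left] using hθ
      have ht := ENNReal.tendsto_atTop_zero_of_tsum_ne_top hsum
      have hc0 : ENNReal.ofReal (r ^ (N - 1)) ≠ 0 := (ENNReal.ofReal_pos.2 (pow_pos hr0 _)).ne'
      have ht' := ENNReal.Tendsto.const_mul (a := (ENNReal.ofReal (r ^ (N - 1)))⁻¹) ht
        (Or.inr (ENNReal.inv_ne_top.2 hc0))
      rw [mul_zero] at ht'
      refine tendsto_of_tendsto_of_tendsto_of_le_of_le' tendsto_const_nhds ht'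
        (Eventually.of_forall fun _ => zero_le) ?_
      filter_upwards [eventually_ge_atTop n₀] with n hn
      rw [← ENNReal.mul_le_iff_le_inv hc0 ENNReal.ofReal_ne_top,
        ← lintegral_const_mul' _ _ ENNReal.ofReal_ne_top]
      refine (setLIntegral_mono' measurableSet_Ioc fun τ hτ => ?_).trans
        (lintegral_mono_set fun τ hτ => hr0.trans hτ.1)
      refine mul_le_mul' (ENNReal.ofReal_le_ofReal (pow_le_pow_left₀ hr0.le hτ.1.le _)) ?_
      have hmem : γ τ ∈ K n := hn₀ n hn (mem_image_of_mem _ (Ioc_subset_Icc_self hτ))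
      rw [hE]
      simp only [indicator_of_mem hmem]
      exact le_add_self

/-- The weighted Poincaré inequality on an interval, for a function that vanishes near the right
end: the weight `r ^ m` is increasing. -/
theorem lintegral_pow_mul_enorm_le (m : ℕ) {lo hi : ℝ} (hlo : 0 ≤ lo)
    {v : ℝ → ℝ} {q : ℝ → ℝ≥0∞} {A : Set ℝ}
    (hA : ∀ᵐ r ∂volume.restrict (Ioo lo hi), r ∈ A)
    (hbound : ∀ r s, r ∈ Ioo lo hi → s ∈ Ioo lo hi → r ≤ s → r ∈ A → s ∈ A →
      ‖v r‖ₑ ≤ ‖v s‖ₑ + ∫⁻ τ in Ioc r s, q τ)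
    {η : ℝ} (hη : η < hi) (hzero : ∀ᵐ s ∂volume.restrict (Ioo lo hi), η < s → v s = 0) :
    ∫⁻ r in Ioo lo hi, ENNReal.ofReal (r ^ m) * ‖v r‖ₑ ≤
      ENNReal.ofReal (hi - lo) * ∫⁻ r in Ioo lo hi, ENNReal.ofReal (r ^ m) * q r := by
  have key : ∀ᵐ r ∂volume.restrict (Ioo lo hi), ENNReal.ofReal (r ^ m) * ‖v r‖ₑ ≤
      ∫⁻ r in Ioo lo hi, ENNReal.ofReal (r ^ m) * q r := by
    filter_upwards [hA, ae_restrict_mem measurableSet_Ioo] with r hrA hr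
    have hlt : max r η < hi := max_lt hr.2 hη
    have hsub : Ioo (max r η) hi ⊆ Ioo lo hi :=
      Ioo_subset_Ioo_left (hr.1.le.trans (le_max_left _ _))
    have hne : (ae (volume.restrict (Ioo (max r η) hi))).NeBot := by
      rw [ae_neBot, Ne, Measure.restrict_eq_zero, Real.volume_Ioo, ENNReal.ofReal_eq_zero]
      linarith
    have hle := Measure.restrict_mono hsub (le_refl (volume : Measure ℝ))
    obtain ⟨s, hsA, hs0, hs⟩ := ((hA.filter_mono (ae_mono hle)).and
      ((hzero.filter_mono (ae_mono hle)).and (ae_restrict_mem measurableSet_Ioo))).exists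
    have hrs : r ≤ s := (le_max_left _ _).trans hs.1.le
    have h1 := hbound r s hr (hsub hs) hrs hrA hsA
    rw [hs0 ((le_max_right _ _).trans_lt hs.1), enorm_zero, zero_add] at h1
    calc ENNReal.ofReal (r ^ m) * ‖v r‖ₑ
        ≤ ENNReal.ofReal (r ^ m) * ∫⁻ τ in Ioc r s, q τ := by gcongr
      _ = ∫⁻ τ in Ioc r s, ENNReal.ofReal (r ^ m) * q τ :=
          (lintegral_const_mul' _ _ ENNReal.ofReal_ne_top).symm
      _ ≤ ∫⁻ τ in Ioc r s, ENNReal.ofReal (τ ^ m) * q τ := by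
          refine setLIntegral_mono' measurableSet_Ioc fun τ hτ => ?_
          gcongr
          · exact hlo.trans hr.1.le
          · exact hτ.1.le
      _ ≤ _ := lintegral_mono_set
          (show Ioc r s ⊆ Ioo lo hi from fun τ hτ => ⟨hr.1.trans hτ.1, hτ.2.trans_lt hs.2⟩)
  refine (lintegral_mono_ae key).trans_eq ?_
  rw [setLIntegral_const, Real.volume_Ioo, mul_comm]

end Rays

/-! ### The radial Poincaré inequality -/

section Poincare

open Filter Topology

variable {N : ℕ} {Ω : Set (EuclideanSpace ℝ (Fin N))} {P : EuclideanSpace ℝ (Fin N)}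

theorem MemSobolev.congr_ae {p : ℝ≥0∞} {v v' : EuclideanSpace ℝ (Fin N) → ℝ}
    {g g' : EuclideanSpace ℝ (Fin N) → EuclideanSpace ℝ (Fin N)} (h : MemSobolev p Ω v g)
    (hv : v =ᵐ[volume.restrict Ω] v') (hg : g =ᵐ[volume.restrict Ω] g') :
    MemSobolev p Ω v' g' where
  memLp := h.memLp.ae_eq hv
  memLp_grad := h.memLp_grad.ae_eq hg
  weak_grad φ hφ hc hs := by
    have h1 : ∫ x in Ω, v' x • gradient φ x = ∫ x in Ω, v x • gradient φ x :=
      integral_congr_ae (by filter_upwards [hv] with x hx; rw [hx])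
    have h2 : ∫ x in Ω, φ x • g' x = ∫ x in Ω, φ x • g x :=
      integral_congr_ae (by filter_upwards [hg] with x hx; rw [hx])
    rw [h1, h2, h.weak_grad φ hφ hc hs]

theorem MemSobolev.mono_exponent {p q : ℝ≥0∞} (hΩ : volume Ω ≠ ⊤)
    {v : EuclideanSpace ℝ (Fin N) → ℝ}
    {g : EuclideanSpace ℝ (Fin N) → EuclideanSpace ℝ (Fin N)} (h : MemSobolev q Ω v g)
    (hpq : p ≤ q) : MemSobolev p Ω v g := by
  have : IsFiniteMeasure (volume.restrict Ω) := ⟨by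
    rw [Measure.restrict_apply_univ]; exact hΩ.lt_top⟩
  exact ⟨h.memLp.mono_exponent hpq, h.memLp_grad.mono_exponent hpq, h.weak_grad⟩

/-- The radial Poincaré inequality: for a function that vanishes near the points where rays from
`P` leave `Ω`, integrate along each ray and then over the directions. -/
theorem lintegral_le_radialWidth_mul (hN : 1 ≤ N) (hΩ : IsOpen Ω) (hb : Bornology.IsBounded Ω)
    (hP : PropertyP Ω P) {v : EuclideanSpace ℝ (Fin N) → ℝ}
    {g : EuclideanSpace ℝ (Fin N) → EuclideanSpace ℝ (Fin N)} (hv : MemSobolev 1 Ω v g)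
    {U : Set (EuclideanSpace ℝ (Fin N))} (hU : IsOpen U) (hΓU : backContactSet Ω P ⊆ U)
    (h0 : ∀ᵐ x ∂volume.restrict (Ω ∩ U), v x = 0) :
    ∫⁻ x in Ω, ‖v x‖ₑ ≤ ENNReal.ofReal (radialWidth Ω P) * ∫⁻ x in Ω, ‖g x‖ₑ := by
  wlog hmeas : Measurable v ∧ Measurable g generalizing v g
  · have hva := hv.memLp.aestronglyMeasurable
    have hga := hv.memLp_grad.aestronglyMeasurable
    have h1 := this (hv.congr_ae hva.ae_eq_mk hga.ae_eq_mk)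
      (by
        have hle := Measure.restrict_mono (inter_subset_left : Ω ∩ U ⊆ Ω)
          (le_refl (volume : Measure (EuclideanSpace ℝ (Fin N))))
        filter_upwards [h0, hva.ae_eq_mk.filter_mono (ae_mono hle)] with x hx hx'
        rw [← hx', hx])
      ⟨hva.stronglyMeasurable_mk.measurable, hga.stronglyMeasurable_mk.measurable⟩
    have e1 : ∫⁻ x in Ω, ‖v x‖ₑ = ∫⁻ x in Ω, ‖hva.mk v x‖ₑ :=
      lintegral_congr_ae (by filter_upwards [hva.ae_eq_mk] with x hx; rw [hx])
    have e2 : ∫⁻ x in Ω, ‖g x‖ₑ = ∫⁻ x in Ω, ‖hga.mk g x‖ₑ :=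
      lintegral_congr_ae (by filter_upwards [hga.ae_eq_mk] with x hx; rw [hx])
    rwa [e1, e2]
  obtain ⟨hvm, hgm⟩ := hmeas
  rw [← lintegral_indicator hΩ.measurableSet, ← lintegral_indicator hΩ.measurableSet,
    lintegral_polar hN P (hvm.enorm.indicator hΩ.measurableSet),
    lintegral_polar hN P (hgm.enorm.indicator hΩ.measurableSet),
    ← lintegral_const_mul' _ _ ENNReal.ofReal_ne_top]
  rw [ae_restrict_iff' (hΩ.inter hU).measurableSet] at h0
  refine lintegral_mono_ae ?_
  filter_upwards [hv.ae_ray_bound hN hΩ hvm hgm P, ae_sphere_ae_ray hN P h0]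
    with θ ⟨A, hA, hbound⟩ hz
  set γ : ℝ → EuclideanSpace ℝ (Fin N) := fun τ => P + τ • (θ : EuclideanSpace ℝ (Fin N))
  have hγc : Continuous γ := by fun_prop
  have hθ1 : ‖(θ : EuclideanSpace ℝ (Fin N))‖ = 1 := by simp
  have hset : ∀ F : EuclideanSpace ℝ (Fin N) → ℝ≥0∞,
      ∫⁻ r in Ioi (0 : ℝ), ENNReal.ofReal (r ^ (N - 1)) * Ω.indicator F (γ r) =
      ∫⁻ r in {r : ℝ | 0 < r ∧ γ r ∈ Ω}, ENNReal.ofReal (r ^ (N - 1)) * F (γ r) := by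
    intro F
    have hs : {r : ℝ | 0 < r ∧ γ r ∈ Ω} = γ ⁻¹' Ω ∩ Ioi 0 := by
      ext r; exact and_comm
    rw [hs, ← Measure.restrict_restrict (hΩ.preimage hγc).measurableSet,
      ← lintegral_indicator (hΩ.preimage hγc).measurableSet]
    refine lintegral_congr fun r => ?_
    by_cases hr : γ r ∈ Ω
    · rw [indicator_of_mem hr, indicator_of_mem (by exact hr)]
    · rw [indicator_of_notMem hr, indicator_of_notMem (by exact hr), mul_zero]
  change ∫⁻ r in Ioi (0 : ℝ), ENNReal.ofReal (r ^ (N - 1)) *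
      Ω.indicator (fun x => ‖v x‖ₑ) (γ r) ≤ ENNReal.ofReal (radialWidth Ω P) *
      ∫⁻ r in Ioi (0 : ℝ), ENNReal.ofReal (r ^ (N - 1)) * Ω.indicator (fun x => ‖g x‖ₑ) (γ r)
  rw [hset, hset]
  rcases {r : ℝ | 0 < r ∧ γ r ∈ Ω}.eq_empty_or_nonempty with he | ⟨r₀, hr₀, hr₀Ω⟩
  · simp [he]
  have hθ : (θ : EuclideanSpace ℝ (Fin N)) ∈ crossSection Ω P :=
    mem_crossSection_of_ray hθ1 hr₀ hr₀Ω
  obtain ⟨K, lo, hi, hray⟩ := hP _ hθ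
  have hin : {r : ℝ | 0 < r ∧ γ r ∈ Ω} = ⋃ k, Ioo (lo k) (hi k) := hray.inside
  rw [hin, lintegral_iUnion (fun k => measurableSet_Ioo) (fun j k hjk => hray.disjoint hjk),
    lintegral_iUnion (fun k => measurableSet_Ioo) (fun j k hjk => hray.disjoint hjk),
    ← ENNReal.tsum_mul_left]
  refine ENNReal.tsum_le_tsum fun k => ?_
  rcases (hray.le k).eq_or_lt with he | hlt
  · simp [he]
  have hpos : Ioo (lo k) (hi k) ⊆ Ioi 0 := fun r hr => (hray.nonneg k).trans_lt hr.1
  have hle := Measure.restrict_mono hpos (le_refl (volume : Measure ℝ))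
  have hmem : γ (hi k) ∈ U := hΓU (hray.hi_mem_backContactSet hθ hlt)
  obtain ⟨η, hη, hηU⟩ := (mem_nhdsLT_iff_exists_Ioo_subset' hlt).1
    (nhdsWithin_le_nhds ((hU.preimage hγc).mem_nhds hmem))
  refine (lintegral_pow_mul_enorm_le (N - 1) (hray.nonneg k) (v := fun r => v (γ r))
    (q := fun r => ‖g (γ r)‖ₑ) (A := A) ?_ ?_ hη ?_).trans ?_
  · filter_upwards [hA.filter_mono (ae_mono hle), ae_restrict_mem measurableSet_Ioo] with r hr hr2
    exact hr (hray.mem_of_mem_Ioo hr2)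
  · intro r s hr hs hrs hrA hsA
    exact hbound r s (hpos hr) hrs hrA hsA fun τ hτ =>
      hray.mem_of_mem_Ioo (k := k) ⟨hr.1.trans_le hτ.1, hτ.2.trans_lt hs.2⟩
  · filter_upwards [hz.filter_mono (ae_mono hle), ae_restrict_mem measurableSet_Ioo]
      with r hr hr2 hrη
    exact hr ⟨hray.mem_of_mem_Ioo hr2, hηU ⟨hrη, hr2.2⟩⟩
  · gcongr
    exact hray.sub_le_radialWidth hb hθ k

end Poincare

/-! ### Functions that vanish on a boundary portion -/

section Composition

open Filter Topology

variable {N : ℕ} {Ω Γ : Set (EuclideanSpace ℝ (Fin N))} {P : EuclideanSpace ℝ (Fin N)}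

theorem MemSobolev.comp {p : ℝ≥0∞} (hp : 1 ≤ p) (hΩ : IsOpen Ω) (hfin : volume Ω ≠ ⊤)
    {v : EuclideanSpace ℝ (Fin N) → ℝ}
    {g : EuclideanSpace ℝ (Fin N) → EuclideanSpace ℝ (Fin N)} (hv : MemSobolev p Ω v g)
    {G G' : ℝ → ℝ} {C : ℝ} (hG : ∀ s, HasDerivAt G (G' s) s)
    (hGc : Continuous G') (hC : ∀ s, |G' s| ≤ C) (hG0 : G 0 = 0) :
    MemSobolev p Ω (fun x => G (v x)) (fun x => G' (v x) • g x) where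
  memLp := by
    have hGcont : Continuous G := continuous_iff_continuousAt.2 fun s => (hG s).continuousAt
    refine hv.memLp.of_le_mul (c := C)
      (hGcont.comp_aestronglyMeasurable hv.memLp.aestronglyMeasurable)
      (Eventually.of_forall fun x => ?_)
    have := abs_sub_le_of_deriv_bound hG hC (v x) 0
    rwa [hG0, sub_zero, sub_zero] at this
  memLp_grad := by
    refine hv.memLp_grad.of_le_mul (c := C)
      ((hGc.comp_aestronglyMeasurable hv.memLp.aestronglyMeasurable).smul
        hv.memLp_grad.aestronglyMeasurable)
      (Eventually.of_forall fun x => ?_)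
    rw [norm_smul]
    gcongr
    exact hC _
  weak_grad φ hφ hc hs :=
    (hv.mono_exponent hfin hp).comp_weak_grad hΩ hG hGc hC hφ hc hs

/-- Dominated convergence in `L^N(Ω)`. -/
theorem tendsto_eLpNorm_of_dominated (hN : 1 ≤ N)
    {F : ℕ → EuclideanSpace ℝ (Fin N) → EuclideanSpace ℝ (Fin N)}
    {g : EuclideanSpace ℝ (Fin N) → EuclideanSpace ℝ (Fin N)}
    (hg : MemLp g (N : ℝ≥0∞) (volume.restrict Ω))
    (hF : ∀ n, AEStronglyMeasurable (F n) (volume.restrict Ω))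
    {C : ℝ} (hb : ∀ n x, ‖F n x‖ ≤ C * ‖g x‖)
    (hlim : ∀ᵐ x ∂volume.restrict Ω, Tendsto (fun n => F n x) atTop (𝓝 0)) :
    Tendsto (fun n => eLpNorm (F n) (N : ℝ≥0∞) (volume.restrict Ω)) atTop (𝓝 0) := by
  have hN0 : (N : ℝ≥0∞) ≠ 0 := by simp; omega
  have hNr : (0 : ℝ) < N := by exact_mod_cast hN
  have hgC : MemLp (fun x => C * ‖g x‖) (N : ℝ≥0∞) (volume.restrict Ω) := hg.norm.const_mul C
  have hfin : ∫⁻ x in Ω, ‖C * ‖g x‖‖ₑ ^ (N : ℝ) ≠ ⊤ := by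
    have := lintegral_rpow_enorm_lt_top_of_eLpNorm_lt_top hN0 (by simp) hgC.eLpNorm_lt_top
    simpa using this.ne
  have h1 : Tendsto (fun n => ∫⁻ x in Ω, ‖F n x‖ₑ ^ (N : ℝ)) atTop (𝓝 (∫⁻ x in Ω, 0)) := by
    refine tendsto_lintegral_of_dominated_convergence' (fun x => ‖C * ‖g x‖‖ₑ ^ (N : ℝ))
      (fun n => (hF n).enorm.pow_const _) (fun n => Eventually.of_forall fun x => ?_) hfin ?_
    · refine ENNReal.rpow_le_rpow ?_ hNr.le
      rw [← ofReal_norm, ← ofReal_norm]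
      exact ENNReal.ofReal_le_ofReal ((hb n x).trans (le_abs_self _))
    · filter_upwards [hlim] with x hx
      have := hx.enorm.ennrpow_const (N : ℝ)
      simpa [ENNReal.zero_rpow_of_pos hNr] using this
  rw [lintegral_zero] at h1
  have h2 := h1.ennrpow_const (1 / (N : ℝ))
  rw [ENNReal.zero_rpow_of_pos (by positivity)] at h2
  refine h2.congr fun n => ?_
  rw [eLpNorm_eq_lintegral_rpow_enorm_toReal hN0 (by simp)]
  simp

/-- Functions that vanish on `Γ` are stable under composition with `C¹` functions that fix `0`
and have bounded derivative. The gradients converge because the approximating functions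
converge almost everywhere along a subsequence. -/
theorem VanishesOn.comp (hN : 1 ≤ N) (hΩ : IsOpen Ω) (hfin : volume Ω ≠ ⊤)
    {v : EuclideanSpace ℝ (Fin N) → ℝ}
    {g : EuclideanSpace ℝ (Fin N) → EuclideanSpace ℝ (Fin N)} (hv : VanishesOn Ω Γ v g)
    {G G' : ℝ → ℝ} {C : ℝ} (hG : ∀ s, HasDerivAt G (G' s) s)
    (hGc : Continuous G') (hC : ∀ s, |G' s| ≤ C) (hG0 : G 0 = 0) :
    VanishesOn Ω Γ (fun x => G (v x)) (fun x => G' (v x) • g x) := by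
  obtain ⟨hvs, happ⟩ := hv
  have hN0 : (N : ℝ≥0∞) ≠ 0 := by simp; omega
  have hN1 : 1 ≤ (N : ℝ≥0∞) := by exact_mod_cast hN
  refine ⟨hvs.comp hN1 hΩ hfin hG hGc hC hG0, fun ε hε => ?_⟩
  have h := fun n : ℕ => happ ((n : ℝ≥0∞) + 1)⁻¹ (by simp)
  choose φ Dφ U hφ hU hΓU hφ0 hd1 hd2 using h
  have h0 := tendsto_inv_natCast_add_one
  have t1 : Tendsto (fun n => eLpNorm (v - φ n) (N : ℝ≥0∞) (volume.restrict Ω)) atTop (𝓝 0) :=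
    tendsto_of_tendsto_of_tendsto_of_le_of_le tendsto_const_nhds h0 (fun _ => zero_le) hd1
  have t2 : Tendsto (fun n => eLpNorm (g - Dφ n) (N : ℝ≥0∞) (volume.restrict Ω)) atTop (𝓝 0) :=
    tendsto_of_tendsto_of_tendsto_of_le_of_le tendsto_const_nhds h0 (fun _ => zero_le) hd2
  obtain ⟨ns, hns, hae⟩ := (tendstoInMeasure_of_tendsto_eLpNorm hN0
    (fun n => (hφ n).memLp.aestronglyMeasurable) hvs.memLp.aestronglyMeasurable
    (by simpa only [eLpNorm_sub_comm] using t1)).exists_seq_tendsto_ae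
  have hm : ∀ n, AEStronglyMeasurable (fun x => (G' (v x) - G' (φ (ns n) x)) • g x)
      (volume.restrict Ω) := fun n =>
    ((hGc.comp_aestronglyMeasurable hvs.memLp.aestronglyMeasurable).sub
      (hGc.comp_aestronglyMeasurable (hφ _).memLp.aestronglyMeasurable)).smul
      hvs.memLp_grad.aestronglyMeasurable
  have hm' : ∀ n, AEStronglyMeasurable (fun x => G' (φ (ns n) x) • (g x - Dφ (ns n) x))
      (volume.restrict Ω) := fun n =>
    (hGc.comp_aestronglyMeasurable (hφ _).memLp.aestronglyMeasurable).smul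
      (hvs.memLp_grad.aestronglyMeasurable.sub (hφ _).memLp_grad.aestronglyMeasurable)
  have t3 : Tendsto (fun n => eLpNorm (fun x => (G' (v x) - G' (φ (ns n) x)) • g x) (N : ℝ≥0∞)
      (volume.restrict Ω)) atTop (𝓝 0) := by
    refine tendsto_eLpNorm_of_dominated hN hvs.memLp_grad hm (C := C + C) (fun n x => ?_) ?_
    · rw [norm_smul]
      gcongr
      exact (norm_sub_le _ _).trans (add_le_add (hC _) (hC _))
    · filter_upwards [hae] with x hx
      have := ((tendsto_const_nhds (x := G' (v x))).sub ((hGc.tendsto _).comp hx)).smul_const (g x)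
      simpa using this
  have t4 : Tendsto (fun n => eLpNorm (fun x => (G' (v x) - G' (φ (ns n) x)) • g x) (N : ℝ≥0∞)
      (volume.restrict Ω) + ENNReal.ofReal C *
        eLpNorm (g - Dφ (ns n)) (N : ℝ≥0∞) (volume.restrict Ω)) atTop (𝓝 0) := by
    have := t3.add (ENNReal.Tendsto.const_mul (a := ENNReal.ofReal C)
      (t2.comp hns.tendsto_atTop) (Or.inr ENNReal.ofReal_ne_top))
    simpa using this
  have t5 : Tendsto (fun n => ENNReal.ofReal C *
      eLpNorm (v - φ (ns n)) (N : ℝ≥0∞) (volume.restrict Ω)) atTop (𝓝 0) := by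
    have := ENNReal.Tendsto.const_mul (a := ENNReal.ofReal C)
      (t1.comp hns.tendsto_atTop) (Or.inr ENNReal.ofReal_ne_top)
    simpa using this
  obtain ⟨n, hn1, hn2⟩ := ((t4.eventually_lt_const hε).and (t5.eventually_lt_const hε)).exists
  refine ⟨fun x => G (φ (ns n) x), fun x => G' (φ (ns n) x) • Dφ (ns n) x, U (ns n),
    (hφ (ns n)).comp hN1 hΩ hfin hG hGc hC hG0, hU _, hΓU _, ?_, ?_, ?_⟩
  · filter_upwards [hφ0 (ns n)] with x hx
    rw [hx, hG0]
  · refine (eLpNorm_le_mul_eLpNorm_of_ae_le_mul (c := C)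
      (Eventually.of_forall fun x => ?_) _).trans hn2.le
    exact abs_sub_le_of_deriv_bound hG hC _ _
  · have e : ((fun x => G' (v x) • g x) - fun x => G' (φ (ns n) x) • Dφ (ns n) x) =
        (fun x => (G' (v x) - G' (φ (ns n) x)) • g x) +
          fun x => G' (φ (ns n) x) • (g x - Dφ (ns n) x) := by
      ext1 x
      simp only [Pi.sub_apply, Pi.add_apply, sub_smul, smul_sub]
      abel
    rw [e]
    refine (eLpNorm_add_le (hm n) (hm' n) hN1).trans (le_trans ?_ hn1.le)
    refine add_le_add le_rfl (eLpNorm_le_mul_eLpNorm_of_ae_le_mul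
      (Eventually.of_forall fun x => ?_) _)
    rw [norm_smul, Pi.sub_apply]
    gcongr
    exact hC _

/-- The radial Poincaré inequality passes to the closure. -/
theorem VanishesOn.lintegral_le (hN : 1 ≤ N) (hΩ : IsOpen Ω) (hb : Bornology.IsBounded Ω)
    (hP : PropertyP Ω P) (hΓ : backContactSet Ω P ⊆ Γ)
    {v : EuclideanSpace ℝ (Fin N) → ℝ}
    {g : EuclideanSpace ℝ (Fin N) → EuclideanSpace ℝ (Fin N)} (hv : VanishesOn Ω Γ v g) :
    eLpNorm v 1 (volume.restrict Ω) ≤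
      ENNReal.ofReal (radialWidth Ω P) * eLpNorm g 1 (volume.restrict Ω) := by
  obtain ⟨hvs, happ⟩ := hv
  have hfin : volume Ω ≠ ⊤ := hb.measure_lt_top.ne
  have hN1 : 1 ≤ (N : ℝ≥0∞) := by exact_mod_cast hN
  set M : ℝ≥0∞ := volume Ω ^ (1 / (1 : ℝ≥0∞).toReal - 1 / (N : ℝ≥0∞).toReal)
  have hMtop : M ≠ ⊤ := by
    refine ENNReal.rpow_ne_top_of_nonneg ?_ hfin
    have : (1 : ℝ) ≤ N := by exact_mod_cast hN
    have := inv_le_one_of_one_le₀ this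
    simp only [ENNReal.toReal_one, ENNReal.toReal_natCast, one_div, inv_one]
    linarith
  have hHolder : ∀ {F : Type} [NormedAddCommGroup F] {f : EuclideanSpace ℝ (Fin N) → F},
      AEStronglyMeasurable f (volume.restrict Ω) → eLpNorm f 1 (volume.restrict Ω) ≤
        eLpNorm f (N : ℝ≥0∞) (volume.restrict Ω) * M := by
    intro F _ f hf
    have := eLpNorm_le_eLpNorm_mul_rpow_measure_univ hN1 hf
    rwa [Measure.restrict_apply_univ] at this
  set d := ENNReal.ofReal (radialWidth Ω P)
  have h0 := tendsto_inv_natCast_add_one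
  have hkey : ∀ n : ℕ, eLpNorm v 1 (volume.restrict Ω) ≤ ((n : ℝ≥0∞) + 1)⁻¹ * M +
      d * (((n : ℝ≥0∞) + 1)⁻¹ * M + eLpNorm g 1 (volume.restrict Ω)) := by
    intro n
    obtain ⟨φ, Dφ, U, hφ, hU, hΓU, hφ0, hd1, hd2⟩ := happ ((n : ℝ≥0∞) + 1)⁻¹ (by simp)
    have hφ1 := hφ.mono_exponent hfin hN1
    have hp := lintegral_le_radialWidth_mul hN hΩ hb hP hφ1 hU (hΓ.trans hΓU) hφ0
    rw [← eLpNorm_one_eq_lintegral_enorm, ← eLpNorm_one_eq_lintegral_enorm] at hp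
    have hv1 := hvs.memLp.aestronglyMeasurable
    have hg1 := hvs.memLp_grad.aestronglyMeasurable
    have hφm := hφ.memLp.aestronglyMeasurable
    have hDm := hφ.memLp_grad.aestronglyMeasurable
    have e1 : v = (v - φ) + φ := (sub_add_cancel _ _).symm
    have e2 : Dφ = (Dφ - g) + g := (sub_add_cancel _ _).symm
    calc eLpNorm v 1 (volume.restrict Ω)
        ≤ eLpNorm (v - φ) 1 (volume.restrict Ω) + eLpNorm φ 1 (volume.restrict Ω) := by
          conv_lhs => rw [e1]
          exact eLpNorm_add_le (hv1.sub hφm) hφm le_rfl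
      _ ≤ ((n : ℝ≥0∞) + 1)⁻¹ * M + d * eLpNorm Dφ 1 (volume.restrict Ω) := by
          refine add_le_add ((hHolder (hv1.sub hφm)).trans ?_) hp
          gcongr
      _ ≤ _ := by
          gcongr
          conv_lhs => rw [e2]
          refine (eLpNorm_add_le (hDm.sub hg1) hg1 le_rfl).trans (add_le_add ?_ le_rfl)
          refine (hHolder (hDm.sub hg1)).trans ?_
          rw [eLpNorm_sub_comm]
          gcongr
  have h1 : Tendsto (fun n : ℕ => ((n : ℝ≥0∞) + 1)⁻¹ * M) atTop (𝓝 0) := by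
    simpa using ENNReal.Tendsto.mul_const h0 (Or.inr hMtop)
  have h2 := h1.add (ENNReal.Tendsto.const_mul (a := d)
    (h1.add (tendsto_const_nhds (x := eLpNorm g 1 (volume.restrict Ω))))
    (Or.inr ENNReal.ofReal_ne_top))
  rw [zero_add, zero_add] at h2
  exact ge_of_tendsto' h2 hkey

end Composition

/-! ### Smooth truncations -/

section Truncation

open Filter Topology

/-- A `C¹` version `T` of the truncation `s ↦ min (max (s - k) 0) t`. Its slope `ρ` is continuous,
takes values in `[0, 1]` and vanishes outside `(k, k + t)`, and its height `M` is almost `t`. -/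
theorem exists_smooth_truncation {k t τ : ℝ} (hτ : 0 < τ) (hτt : τ < t) :
    ∃ (ρ T : ℝ → ℝ) (M : ℝ), Continuous ρ ∧ (∀ s, HasDerivAt T (ρ s) s) ∧ (∀ s, 0 ≤ ρ s) ∧
      (∀ s, ρ s ≤ 1) ∧ (∀ s, s ≤ k → ρ s = 0) ∧ (∀ s, k + t ≤ s → ρ s = 0) ∧
      (∀ s, s ≤ k → T s = 0) ∧ τ ≤ M ∧ (∀ s, k + t ≤ s → T s = M) ∧ (∀ s, 0 ≤ T s) ∧
      ∀ s, T s ≤ M := by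
  set δ := (t - τ) / 2 with hδ
  have hδ0 : 0 < δ := by rw [hδ]; linarith
  set ρ : ℝ → ℝ := fun r => max 0 (min 1 (min ((r - k) / δ) ((k + t - r) / δ))) with hρ
  have hρc : Continuous ρ := by fun_prop
  have hρ0 : ∀ s, 0 ≤ ρ s := fun s => le_max_left _ _
  have hρ1 : ∀ s, ρ s ≤ 1 := fun s => max_le zero_le_one (min_le_left _ _)
  have hρk : ∀ s, s ≤ k → ρ s = 0 := fun s hs => by
    refine max_eq_left ((min_le_right _ _).trans ((min_le_left _ _).trans ?_))
    exact div_nonpos_of_nonpos_of_nonneg (by linarith) hδ0.le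
  have hρt : ∀ s, k + t ≤ s → ρ s = 0 := fun s hs => by
    refine max_eq_left ((min_le_right _ _).trans ((min_le_right _ _).trans ?_))
    exact div_nonpos_of_nonpos_of_nonneg (by linarith) hδ0.le
  have hρmid : ∀ s ∈ Icc (k + δ) (k + t - δ), ρ s = 1 := fun s hs => by
    have h1 : 1 ≤ (s - k) / δ := (one_le_div hδ0).2 (by linarith [hs.1])
    have h2 : 1 ≤ (k + t - s) / δ := (one_le_div hδ0).2 (by linarith [hs.2])
    simp only [hρ, min_eq_left (le_min h1 h2), max_eq_right zero_le_one]
  set T : ℝ → ℝ := fun s => ∫ r in k..s, ρ r with hT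
  have hi : ∀ a b, IntervalIntegrable ρ volume a b := fun a b => hρc.intervalIntegrable a b
  have hTd : ∀ s, HasDerivAt T (ρ s) s := fun s =>
    intervalIntegral.integral_hasDerivAt_right (hi _ _)
      hρc.aestronglyMeasurable.stronglyMeasurableAtFilter hρc.continuousAt
  have hmono : Monotone T := monotone_of_hasDerivAt_nonneg hTd hρ0
  have hTk : ∀ s, s ≤ k → T s = 0 := fun s hs => by
    refine (intervalIntegral.integral_congr (g := fun _ => (0 : ℝ)) fun r hr => ?_).trans (by simp)
    rw [uIcc_of_ge hs] at hr
    exact hρk r hr.2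
  have hTt : ∀ s, k + t ≤ s → T s = T (k + t) := fun s hs => by
    change ∫ r in k..s, ρ r = ∫ r in k..(k + t), ρ r
    rw [← intervalIntegral.integral_add_adjacent_intervals (hi k (k + t)) (hi (k + t) s)]
    have : ∫ r in (k + t)..s, ρ r = 0 := by
      refine (intervalIntegral.integral_congr (g := fun _ => (0 : ℝ))
        fun r hr => ?_).trans (by simp)
      rw [uIcc_of_le hs] at hr
      exact hρt r hr.1
    rw [this, add_zero]
  have hT0 : ∀ s, 0 ≤ T s := fun s => by
    rcases le_total s k with hs | hs
    · rw [hTk s hs]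
    · rw [← hTk k le_rfl]; exact hmono hs
  refine ⟨ρ, T, T (k + t), hρc, hTd, hρ0, hρ1, hρk, hρt, hTk, ?_, hTt, hT0, fun s => ?_⟩
  · have h1 : T (k + t - δ) - T (k + δ) = τ := by
      rw [hT, intervalIntegral.integral_interval_sub_left (hi _ _) (hi _ _)]
      refine (intervalIntegral.integral_congr (g := fun _ => (1 : ℝ)) fun r hr => ?_).trans ?_
      · rw [uIcc_of_le (by rw [hδ]; linarith)] at hr
        exact hρmid r hr
      · simp [hδ]; ring
    have h2 := hmono (show k + t - δ ≤ k + t by linarith)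
    have h3 := hT0 (k + δ)
    linarith
  · rcases le_total s (k + t) with hs | hs
    · exact hmono hs
    · exact (hTt s hs).le

end Truncation

/-! ### The energy estimate -/

section Energy

open Filter Topology

variable {N : ℕ} {H : EuclideanSpace ℝ (Fin N) → ℝ} {Ω Γ : Set (EuclideanSpace ℝ (Fin N))}
  {P : EuclideanSpace ℝ (Fin N)}

theorem integrable_inner_finslerField (hN : 2 ≤ N) (hH : IsGauge H)
    (hC2 : ContDiffOn ℝ 2 H {0}ᶜ) {p q : EuclideanSpace ℝ (Fin N) → EuclideanSpace ℝ (Fin N)}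
    (hp : MemLp p (N : ℝ≥0∞) (volume.restrict Ω)) (hq : MemLp q (N : ℝ≥0∞) (volume.restrict Ω)) :
    Integrable (fun x => inner ℝ (finslerField H (p x)) (q x)) (volume.restrict Ω) := by
  obtain ⟨C, hC0, hC⟩ := exists_norm_finslerField_le hN hH hC2
  have hN0 : N ≠ 0 := by omega
  have h1 := hp.integrable_norm_pow hN0
  have h2 := hq.integrable_norm_pow hN0
  refine ((h1.add h2).const_mul C).mono' ?_ (Eventually.of_forall fun x => ?_)
  · exact ((measurable_finslerField hH).comp_aemeasurable
      hp.aestronglyMeasurable.aemeasurable).aestronglyMeasurable.inner hq.aestronglyMeasurable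
  · refine (norm_inner_le_norm _ _).trans ?_
    have hsucc : ∀ a : ℝ, a ^ N = a ^ (N - 1) * a := fun a => by
      rw [← pow_succ]; congr 1; omega
    have hle : ‖p x‖ ^ (N - 1) * ‖q x‖ ≤ ‖p x‖ ^ N + ‖q x‖ ^ N := by
      rw [hsucc, hsucc]
      rcases le_total ‖p x‖ ‖q x‖ with h | h
      · have : ‖p x‖ ^ (N - 1) * ‖q x‖ ≤ ‖q x‖ ^ (N - 1) * ‖q x‖ := by gcongr
        have h0 : 0 ≤ ‖p x‖ ^ (N - 1) * ‖p x‖ := by positivity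
        linarith
      · have : ‖p x‖ ^ (N - 1) * ‖q x‖ ≤ ‖p x‖ ^ (N - 1) * ‖p x‖ := by gcongr
        have h0 : 0 ≤ ‖q x‖ ^ (N - 1) * ‖q x‖ := by positivity
        linarith
    calc ‖finslerField H (p x)‖ * ‖q x‖ ≤ C * ‖p x‖ ^ (N - 1) * ‖q x‖ := by
          gcongr; exact hC _
      _ = C * (‖p x‖ ^ (N - 1) * ‖q x‖) := by ring
      _ ≤ _ := by
          simp only [Pi.add_apply]
          gcongr

/-- The energy estimate: test both equations with `G(u - h)`. -/
theorem energy_estimate (hN : 2 ≤ N) (hH : IsGauge H) (hC2 : ContDiffOn ℝ 2 H {0}ᶜ) {c₁ : ℝ}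
    (hc₁ : 0 ≤ c₁)
    (hmono : ∀ ξ₁ ξ₂ : EuclideanSpace ℝ (Fin N), c₁ * (‖ξ₁‖ + ‖ξ₂‖) ^ (N - 2) * ‖ξ₁ - ξ₂‖ ^ 2 ≤
      inner ℝ (finslerField H ξ₁ - finslerField H ξ₂) (ξ₁ - ξ₂))
    (hΩ : IsOpen Ω) (hfin : volume Ω ≠ ⊤) {f u h : EuclideanSpace ℝ (Fin N) → ℝ}
    {Du Dh : EuclideanSpace ℝ (Fin N) → EuclideanSpace ℝ (Fin N)} (hf : IntegrableOn f Ω)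
    (hu : MemSobolev (N : ℝ≥0∞) Ω u Du) (hh : MemSobolev (N : ℝ≥0∞) Ω h Dh)
    (hus : IsWeakSolution H Ω Γ Du f) (hhs : IsWeakSolution H Ω Γ Dh 0)
    (hv : VanishesOn Ω Γ (u - h) (Du - Dh)) {G R : ℝ → ℝ} {M : ℝ}
    (hG : ∀ s, HasDerivAt G (R s) s) (hR : Continuous R) (hR0 : ∀ s, 0 ≤ R s)
    (hR1 : ∀ s, R s ≤ 1) (hG0 : G 0 = 0) (hGM : ∀ s, |G s| ≤ M) :
    Integrable (fun x => R ((u - h) x) * ‖(Du - Dh) x‖ ^ N) (volume.restrict Ω) ∧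
    c₁ * ∫ x in Ω, R ((u - h) x) * ‖(Du - Dh) x‖ ^ N ≤ M * ∫ x in Ω, |f x| := by
  have hGcont : Continuous G := continuous_iff_continuousAt.2 fun s => (hG s).continuousAt
  have hRabs : ∀ s, |R s| ≤ 1 := fun s => by rw [abs_of_nonneg (hR0 s)]; exact hR1 s
  have htest := hv.comp (by omega) hΩ hfin hG hR hRabs hG0
  have hwm := hv.1.memLp.aestronglyMeasurable
  have hGm : AEStronglyMeasurable (fun x => G ((u - h) x)) (volume.restrict Ω) :=
    hGcont.comp_aestronglyMeasurable hwm
  have htop : MemLp (fun x => G ((u - h) x)) ⊤ (volume.restrict Ω) :=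
    memLp_top_of_bound hGm M (Eventually.of_forall fun x => hGM _)
  have e1 := hus _ _ htest htop
  have e2 := hhs _ _ htest htop
  have i1 := integrable_inner_finslerField hN hH hC2 hu.memLp_grad htest.1.memLp_grad
  have i2 := integrable_inner_finslerField hN hH hC2 hh.memLp_grad htest.1.memLp_grad
  have e3 := integral_sub i1 i2
  rw [e1, e2] at e3
  simp only [Pi.zero_apply, zero_mul, integral_zero, sub_zero] at e3
  have iL : Integrable (fun x => R ((u - h) x) * ‖(Du - Dh) x‖ ^ N) (volume.restrict Ω) :=
    (hv.1.memLp_grad.integrable_norm_pow (by omega)).bdd_mul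
      (hR.comp_aestronglyMeasurable hwm) (Eventually.of_forall fun x => hRabs _)
  refine ⟨iL, ?_⟩
  rw [← integral_const_mul]
  calc ∫ x in Ω, c₁ * (R ((u - h) x) * ‖(Du - Dh) x‖ ^ N)
      ≤ ∫ x in Ω, (inner ℝ (finslerField H (Du x)) (R ((u - h) x) • (Du - Dh) x) -
          inner ℝ (finslerField H (Dh x)) (R ((u - h) x) • (Du - Dh) x)) := by
        refine integral_mono (iL.const_mul c₁) (i1.sub i2) fun x => ?_
        have h1 := (norm_pow_le_of_strongly_monotone hN hc₁ (Du x) (Dh x)).trans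
          (hmono (Du x) (Dh x))
        have h2 := mul_le_mul_of_nonneg_left h1 (hR0 ((u - h) x))
        simp only [real_inner_smul_right, ← mul_sub, ← inner_sub_left]
        simp only [Pi.sub_apply] at h2 ⊢
        linarith
    _ = ∫ x in Ω, f x * G ((u - h) x) := e3
    _ ≤ ∫ x in Ω, M * |f x| := by
        have iR : Integrable (fun x => f x * G ((u - h) x)) (volume.restrict Ω) :=
          hf.mul_bdd hGm (Eventually.of_forall fun x => hGM _)
        refine integral_mono iR (hf.abs.const_mul M) fun x => ?_
        refine (le_abs_self _).trans ?_
        rw [abs_mul, mul_comm]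
        exact mul_le_mul_of_nonneg_right (hGM _) (abs_nonneg _)
    _ = _ := integral_const_mul _ _

end Energy

/-! ### The Sobolev constant -/

section SobolevConstant

open Filter Topology

variable {N : ℕ} {Ω : Set (EuclideanSpace ℝ (Fin N))}

theorem memSobolev_one (hfin : volume Ω ≠ ⊤) :
    MemSobolev 1 Ω (fun _ => 1) (fun _ => 0) where
  memLp := by
    have : IsFiniteMeasure (volume.restrict Ω) := ⟨by
      rw [Measure.restrict_apply_univ]; exact hfin.lt_top⟩
    exact memLp_const 1
  memLp_grad := MemLp.zero'
  weak_grad φ hφ hc hs := by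
    simp only [one_smul, smul_zero, integral_zero, neg_zero]
    have hφ'c : Continuous (fderiv ℝ φ) := hφ.continuous_fderiv (by simp)
    have hgradc : Continuous (gradient φ) :=
      continuous_gradient_of_contDiff hφ
    have hφ'0 : ∀ x, x ∉ tsupport φ → fderiv ℝ φ x = 0 := fun x hx =>
      image_eq_zero_of_notMem_tsupport fun h => hx (tsupport_fderiv_subset ℝ h)
    have hg0 : ∀ x, x ∉ tsupport φ → gradient φ x = 0 := fun x hx => by
      simp [gradient, hφ'0 x hx]
    rw [setIntegral_eq_integral_of_forall_compl_eq_zero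
      (fun x hx => hg0 x fun h => hx (hs h))]
    have hi : Integrable (gradient φ) :=
      hgradc.integrable_of_hasCompactSupport (HasCompactSupport.intro hc hg0)
    refine ext_inner_left ℝ fun e => ?_
    rw [← integral_inner hi, inner_zero_right]
    simp only [real_inner_comm _ e]
    simp only [inner_gradient_eq_fderiv]
    have hi1 : Integrable fun x => fderiv ℝ φ x e :=
      (hφ'c.clm_apply continuous_const).integrable_of_hasCompactSupport
        (HasCompactSupport.intro hc fun x hx => by rw [hφ'0 x hx]; rfl)
    have := integral_mul_fderiv_eq_neg_fderiv_mul_of_integrable (μ := volume) (v := e)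
      (f := fun _ : EuclideanSpace ℝ (Fin N) => (1 : ℝ)) (g := φ) (by simp) (by simpa using hi1)
      (by simpa using hφ.continuous.integrable_of_hasCompactSupport hc) (by simp)
      (fun x _ => (hφ.differentiable (by simp)) x)
    simpa using this

/-- The infimum that defines `S(Ω)` is attained, and it is positive (test with constants). -/
theorem isSobolevConst_sobolevConst (hN : 2 ≤ N) (hne : volume Ω ≠ 0) (hfin : volume Ω ≠ ⊤)
    (hex : ∃ S, IsSobolevConst Ω S) :
    IsSobolevConst Ω (sobolevConst Ω) ∧ 0 < sobolevConst Ω := by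
  set q : ℝ≥0∞ := ENNReal.ofReal ((N : ℝ) / ((N : ℝ) - 1))
  have hlow : ∀ {v : EuclideanSpace ℝ (Fin N) → ℝ}
      {g : EuclideanSpace ℝ (Fin N) → EuclideanSpace ℝ (Fin N)}, MemSobolev 1 Ω v g →
      ∀ S, IsSobolevConst Ω S → (eLpNorm v q (volume.restrict Ω)).toReal ≤
        S * (eLpNorm v 1 (volume.restrict Ω) + eLpNorm g 1 (volume.restrict Ω)).toReal := by
    intro v g hvg S hS
    have hA : eLpNorm v 1 (volume.restrict Ω) + eLpNorm g 1 (volume.restrict Ω) ≠ ⊤ :=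
      (ENNReal.add_lt_top.2 ⟨hvg.memLp.eLpNorm_lt_top, hvg.memLp_grad.eLpNorm_lt_top⟩).ne
    have := ENNReal.toReal_mono (ENNReal.mul_ne_top ENNReal.ofReal_ne_top hA) (hS.2 v g hvg)
    rwa [ENNReal.toReal_mul, ENNReal.toReal_ofReal hS.1] at this
  have hinf : ∀ {a b : ℝ}, 0 ≤ b → (∀ S, IsSobolevConst Ω S → a ≤ S * b) →
      a ≤ sobolevConst Ω * b := by
    intro a b hb h
    rcases hb.eq_or_lt with h0 | h0
    · obtain ⟨S, hS⟩ := hex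
      have := h S hS
      rw [← h0, mul_zero] at this ⊢
      exact this
    · rw [← div_le_iff₀ h0]
      exact le_csInf hex fun S hS => (div_le_iff₀ h0).2 (h S hS)
  have hnonneg : 0 ≤ sobolevConst Ω := Real.sInf_nonneg fun S hS => hS.1
  refine ⟨⟨hnonneg, fun v g hvg => ?_⟩, ?_⟩
  · have hA : eLpNorm v 1 (volume.restrict Ω) + eLpNorm g 1 (volume.restrict Ω) ≠ ⊤ :=
      (ENNReal.add_lt_top.2 ⟨hvg.memLp.eLpNorm_lt_top, hvg.memLp_grad.eLpNorm_lt_top⟩).ne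
    obtain ⟨S, hS⟩ := hex
    have hL : eLpNorm v q (volume.restrict Ω) ≠ ⊤ :=
      ((hS.2 v g hvg).trans_lt (ENNReal.mul_lt_top ENNReal.ofReal_lt_top hA.lt_top)).ne
    rw [← ENNReal.ofReal_toReal hL, ← ENNReal.ofReal_toReal hA, ← ENNReal.ofReal_mul hnonneg]
    exact ENNReal.ofReal_le_ofReal (hinf ENNReal.toReal_nonneg (hlow hvg))
  · have h1 := hinf ENNReal.toReal_nonneg (hlow (memSobolev_one hfin))
    have hpos : 0 < (eLpNorm (fun _ : EuclideanSpace ℝ (Fin N) => (1 : ℝ)) q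
        (volume.restrict Ω)).toReal := by
      obtain ⟨S, hS⟩ := hex
      have hvg := memSobolev_one hfin
      have hA : eLpNorm (fun _ : EuclideanSpace ℝ (Fin N) => (1 : ℝ)) 1 (volume.restrict Ω) +
          eLpNorm (fun _ : EuclideanSpace ℝ (Fin N) => (0 : EuclideanSpace ℝ (Fin N))) 1
            (volume.restrict Ω) ≠ ⊤ :=
        (ENNReal.add_lt_top.2 ⟨hvg.memLp.eLpNorm_lt_top, hvg.memLp_grad.eLpNorm_lt_top⟩).ne
      have hL := ((hS.2 _ _ hvg).trans_lt (ENNReal.mul_lt_top ENNReal.ofReal_lt_top hA.lt_top)).ne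
      refine ENNReal.toReal_pos ?_ hL
      have hNr : (2 : ℝ) ≤ N := by exact_mod_cast hN
      have hq0 : q ≠ 0 := (ENNReal.ofReal_pos.2 (div_pos (by linarith) (by linarith))).ne'
      have hμ0 : volume.restrict Ω ≠ 0 := by rwa [Ne, Measure.restrict_eq_zero]
      rw [eLpNorm_const _ hq0 hμ0, Measure.restrict_apply_univ]
      have := (ENNReal.rpow_pos (p := 1 / q.toReal) (pos_iff_ne_zero.2 hne) hfin).ne'
      simpa using this
    by_contra hcon
    rw [le_antisymm (not_lt.1 hcon) hnonneg, zero_mul] at h1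
    exact absurd h1 (not_le.2 hpos)

end SobolevConstant

/-! ### Comparison of level sets -/

section LevelSetEstimate

open Filter Topology

/-- Raising the outcome of the Sobolev and Hölder inequalities to the power `n / (n - 1)` produces
the constant `μ_Ω`: one factor `M` survives on the left. -/
theorem mul_le_of_rpow_le {n M B c Φ ν σ : ℝ} (hn : 1 < n) (hM : 0 < M) (hB : 0 < B) (hc : 0 < c)
    (hΦ : 0 ≤ Φ) (hν : 0 ≤ ν) (hσ : 0 ≤ σ)
    (h : M * ν ^ ((n - 1) / n) ≤ B * (M * Φ / c) ^ (1 / n) * σ ^ ((n - 1) / n)) :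
    M * ν ≤ ((c ^ (1 / n) / B) ^ (n / (n - 1)))⁻¹ * Φ ^ (1 / (n - 1)) * σ := by
  have hn0 : 0 < n := by linarith
  have hn1 : 0 < n - 1 := by linarith
  have hp : 0 ≤ n / (n - 1) := by positivity
  have e1 : (n - 1) / n * (n / (n - 1)) = 1 := by field_simp
  have e2 : 1 / n * (n / (n - 1)) = 1 / (n - 1) := by field_simp
  have e3 : n / (n - 1) = 1 + 1 / (n - 1) := by field_simp; ring
  have h1 := Real.rpow_le_rpow (by positivity) h hp
  rw [Real.mul_rpow hM.le (by positivity), Real.mul_rpow (by positivity) (by positivity),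
    Real.mul_rpow hB.le (by positivity), ← Real.rpow_mul hν, ← Real.rpow_mul hσ,
    ← Real.rpow_mul (by positivity), e1, e2, Real.rpow_one, Real.rpow_one,
    Real.div_rpow (by positivity) hc.le, Real.mul_rpow hM.le hΦ] at h1
  rw [Real.div_rpow (by positivity) hB.le, ← Real.rpow_mul hc.le, e2, inv_div]
  have h2 : M ^ (n / (n - 1)) = M * M ^ (1 / (n - 1)) := by
    rw [e3, Real.rpow_add hM, Real.rpow_one]
  rw [h2] at h1
  have hMs : 0 < M ^ (1 / (n - 1)) := Real.rpow_pos_of_pos hM _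
  refine le_of_mul_le_mul_left ?_ hMs
  calc M ^ (1 / (n - 1)) * (M * ν) = M * M ^ (1 / (n - 1)) * ν := by ring
    _ ≤ _ := h1
    _ = _ := by ring

variable {N : ℕ} {H : EuclideanSpace ℝ (Fin N) → ℝ} {Ω Γ : Set (EuclideanSpace ℝ (Fin N))}
  {P : EuclideanSpace ℝ (Fin N)}

theorem muConst_pos {c₁ : ℝ} (hc₁ : 0 < c₁) (hS : 0 < sobolevConst Ω) : 0 < muConst c₁ Ω P := by
  have := radialWidth_nonneg (Ω := Ω) (P := P)
  unfold muConst
  positivity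

/-- Comparison of `{k + t ≤ |u - h|}` with `{k < |u - h| < k + t}`, from the energy estimate, the
radial Poincaré inequality and the Sobolev inequality for a truncation of `u - h` between the
levels `k` and `k + t`. As the truncation is smooth, its height `M` can be any number below `t`,
but not `t`. -/
theorem exists_height_mul_le (hN : 2 ≤ N) (hH : IsGauge H) (hC2 : ContDiffOn ℝ 2 H {0}ᶜ) {c₁ : ℝ}
    (hc₁ : 0 < c₁)
    (hmono : ∀ ξ₁ ξ₂ : EuclideanSpace ℝ (Fin N), c₁ * (‖ξ₁‖ + ‖ξ₂‖) ^ (N - 2) * ‖ξ₁ - ξ₂‖ ^ 2 ≤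
      inner ℝ (finslerField H ξ₁ - finslerField H ξ₂) (ξ₁ - ξ₂))
    (hΩ : IsOpen Ω) (hb : Bornology.IsBounded Ω) (hS : IsSobolevConst Ω (sobolevConst Ω))
    (hSpos : 0 < sobolevConst Ω) (hP : PropertyP Ω P) (hΓ : backContactSet Ω P ⊆ Γ)
    {f u h : EuclideanSpace ℝ (Fin N) → ℝ}
    {Du Dh : EuclideanSpace ℝ (Fin N) → EuclideanSpace ℝ (Fin N)} (hf : IntegrableOn f Ω)
    (hu : MemSobolev (N : ℝ≥0∞) Ω u Du) (hh : MemSobolev (N : ℝ≥0∞) Ω h Dh)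
    (hus : IsWeakSolution H Ω Γ Du f) (hhs : IsWeakSolution H Ω Γ Dh 0)
    (hv : VanishesOn Ω Γ (u - h) (Du - Dh)) {k t τ : ℝ} (hk : 0 ≤ k) (hτ : 0 < τ) (hτt : τ < t) :
    ∃ M, τ ≤ M ∧ M * (volume.restrict Ω).real {x | k + t ≤ |(u - h) x|} ≤
      (muConst c₁ Ω P)⁻¹ * (∫ x in Ω, |f x|) ^ (1 / ((N : ℝ) - 1)) *
        (volume.restrict Ω).real {x | k < |(u - h) x| ∧ |(u - h) x| < k + t} := by
  obtain ⟨ρ, T, M, hρc, hT, hρ0, hρ1, hρk, hρt, hTk, hτM, hTt, hT0, hTM⟩ :=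
    exists_smooth_truncation (k := k) hτ hτt
  refine ⟨M, hτM, ?_⟩
  have hM : 0 < M := hτ.trans_le hτM
  have hfin : volume Ω ≠ ⊤ := hb.measure_lt_top.ne
  set μ := volume.restrict Ω with hμ
  have : IsFiniteMeasure μ := ⟨by
    rw [hμ, Measure.restrict_apply_univ]; exact hfin.lt_top⟩
  set w := u - h
  set Dw := Du - Dh
  have hwm : AEStronglyMeasurable w μ := hv.1.memLp.aestronglyMeasurable
  have hDwm : AEStronglyMeasurable Dw μ := hv.1.memLp_grad.aestronglyMeasurable
  have hneg : ∀ s, HasDerivAt (fun s => T (-s)) (-ρ (-s)) s := fun s => by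
    simpa [Function.comp_def] using (hT (-s)).comp s (hasDerivAt_neg s)
  -- `R` is the slope of the odd truncation `s ↦ T s - T (-s)`, whose absolute value is
  -- `T s + T (-s)`: one of the two terms is always zero because `0 ≤ k`.
  set R : ℝ → ℝ := fun s => ρ s + ρ (-s) with hR
  have hRc : Continuous R := by fun_prop
  have hR0 : ∀ s, 0 ≤ R s := fun s => add_nonneg (hρ0 _) (hρ0 _)
  have hR1 : ∀ s, R s ≤ 1 := fun s => by
    rcases le_total 0 s with hs | hs
    · simp only [hR, hρk (-s) (by linarith), add_zero, hρ1 s]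
    · simp only [hR, hρk s (by linarith), zero_add, hρ1 (-s)]
  have hRsupp : ∀ s, ¬ (k < |s| ∧ |s| < k + t) → R s = 0 := by
    intro s hs
    have hz : ∀ a, ¬ (k < a ∧ a < k + t) → ρ a = 0 := fun a ha => by
      rcases not_and_or.1 ha with h | h
      · exact hρk a (not_lt.1 h)
      · exact hρt a (not_lt.1 h)
    rcases le_total 0 s with h0 | h0
    · rw [abs_of_nonneg h0] at hs
      simp only [hR, hz s hs, hρk (-s) (by linarith), add_zero]
    · rw [abs_of_nonpos h0] at hs
      simp only [hR, hz (-s) hs, hρk s (by linarith), add_zero]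
  have hG : ∀ s, HasDerivAt (fun s => T s - T (-s)) (R s) s := fun s => by
    have := (hT s).sub (hneg s)
    rwa [sub_neg_eq_add] at this
  have hB : ∀ s, HasDerivAt (fun s => T s + T (-s)) (ρ s - ρ (-s)) s := fun s => by
    have := (hT s).add (hneg s)
    rwa [← sub_eq_add_neg] at this
  have hBc : Continuous fun s => ρ s - ρ (-s) := by fun_prop
  have hBR : ∀ s, |ρ s - ρ (-s)| ≤ R s := fun s => by
    rw [abs_le]
    constructor <;> simp only [hR] <;> linarith [hρ0 s, hρ0 (-s)]
  have hGM : ∀ s, |T s - T (-s)| ≤ M := fun s => by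
    rw [abs_le]
    constructor <;> linarith [hT0 s, hT0 (-s), hTM s, hTM (-s)]
  have hBM : ∀ s, k + t ≤ |s| → M ≤ T s + T (-s) := fun s hs => by
    rcases le_total 0 s with h0 | h0
    · rw [abs_of_nonneg h0] at hs
      linarith [hTt s hs, hT0 (-s)]
    · rw [abs_of_nonpos h0] at hs
      linarith [hTt (-s) hs, hT0 s]
  obtain ⟨iE, hE⟩ := energy_estimate hN hH hC2 hc₁.le hmono hΩ hfin hf hu hh hus hhs
    hv hG hRc hR0 hR1 (by simp) hGM
  set Φ := ∫ x in Ω, |f x|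
  have hΦ0 : 0 ≤ Φ := integral_nonneg fun x => abs_nonneg _
  have hN1 : 1 ≤ (N : ℝ≥0∞) := by exact_mod_cast (by omega : 1 ≤ N)
  have hN0 : (N : ℝ≥0∞) ≠ 0 := by simp; omega
  have hNr : (2 : ℝ) ≤ N := by exact_mod_cast hN
  set S : Set (EuclideanSpace ℝ (Fin N)) := {x | k < |w x| ∧ |w x| < k + t}
  set F : EuclideanSpace ℝ (Fin N) → EuclideanSpace ℝ (Fin N) := fun x => R (w x) • Dw x with hF
  have hFm : AEStronglyMeasurable F μ := (hRc.comp_aestronglyMeasurable hwm).smul hDwm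
  have hFsupp : Function.support F ⊆ S := fun x hx => by
    by_contra hxS
    exact hx (by simp only [hF, hRsupp _ hxS, zero_smul])
  have hFN : eLpNorm F N μ ≤ ENNReal.ofReal ((M * Φ / c₁) ^ (1 / (N : ℝ))) := by
    have h1 : ∫⁻ x, ‖F x‖ₑ ^ (N : ℝ) ∂μ ≤ ENNReal.ofReal (M * Φ / c₁) := by
      calc ∫⁻ x, ‖F x‖ₑ ^ (N : ℝ) ∂μ
          ≤ ∫⁻ x, ENNReal.ofReal (R (w x) * ‖Dw x‖ ^ N) ∂μ := by
            refine lintegral_mono fun x => ?_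
            rw [ENNReal.rpow_natCast, ← ofReal_norm, ← ENNReal.ofReal_pow (norm_nonneg _)]
            refine ENNReal.ofReal_le_ofReal ?_
            rw [norm_smul, mul_pow, Real.norm_of_nonneg (hR0 _)]
            gcongr
            exact pow_le_of_le_one (hR0 _) (hR1 _) (by omega)
        _ = ENNReal.ofReal (∫ x, R (w x) * ‖Dw x‖ ^ N ∂μ) :=
            (ofReal_integral_eq_lintegral_ofReal iE (Eventually.of_forall fun x =>
              mul_nonneg (hR0 _) (by positivity))).symm
        _ ≤ _ := by
            refine ENNReal.ofReal_le_ofReal ?_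
            rw [le_div_iff₀ hc₁, mul_comm]
            exact hE
    rw [eLpNorm_eq_lintegral_rpow_enorm_toReal hN0 (by simp), ENNReal.toReal_natCast,
      ← ENNReal.ofReal_rpow_of_nonneg (by positivity) (by positivity)]
    exact ENNReal.rpow_le_rpow h1 (by positivity)
  have hF1 : eLpNorm F 1 μ ≤ ENNReal.ofReal ((M * Φ / c₁) ^ (1 / (N : ℝ))) *
      μ S ^ (((N : ℝ) - 1) / N) := by
    rw [← eLpNorm_restrict_eq_of_support_subset hFsupp]
    refine (eLpNorm_le_eLpNorm_mul_rpow_measure_univ hN1 hFm.restrict).trans ?_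
    rw [Measure.restrict_apply_univ, ENNReal.toReal_one, ENNReal.toReal_natCast]
    have e : 1 / (1 : ℝ) - 1 / (N : ℝ) = ((N : ℝ) - 1) / N := by field_simp
    rw [e]
    gcongr
    exact (eLpNorm_mono_measure F Measure.restrict_le_self).trans hFN
  have hBabs : ∀ s, |ρ s - ρ (-s)| ≤ 1 := fun s => (hBR s).trans (hR1 s)
  have hB0 : T 0 + T (-0) = 0 := by rw [neg_zero, hTk 0 hk, add_zero]
  have hvan := hv.comp (by omega) hΩ hfin hB hBc hBabs hB0
  have hpoin := hvan.lintegral_le (by omega) hΩ hb hP hΓ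
  have hsob := hS.2 _ _ (hvan.1.mono_exponent hfin hN1)
  rw [← hμ] at hpoin hsob
  set V : EuclideanSpace ℝ (Fin N) → ℝ := fun x => T (w x) + T (-w x)
  set DV : EuclideanSpace ℝ (Fin N) → EuclideanSpace ℝ (Fin N) :=
    fun x => (ρ (w x) - ρ (-w x)) • Dw x with hDV
  have hDVF : eLpNorm DV 1 μ ≤ eLpNorm F 1 μ := by
    refine eLpNorm_mono fun x => ?_
    rw [hDV, hF, norm_smul, norm_smul, Real.norm_of_nonneg (hR0 _)]
    gcongr
    exact hBR _
  set q : ℝ≥0∞ := ENNReal.ofReal ((N : ℝ) / ((N : ℝ) - 1))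
  have hqr : 0 < (N : ℝ) / ((N : ℝ) - 1) := div_pos (by linarith) (by linarith)
  have hq0 : q ≠ 0 := (ENNReal.ofReal_pos.2 hqr).ne'
  set L : Set (EuclideanSpace ℝ (Fin N)) := {x | k + t ≤ |w x|}
  have hLm : NullMeasurableSet L μ :=
    nullMeasurableSet_le aemeasurable_const (hwm.norm.aemeasurable)
  have hlow : ENNReal.ofReal M * μ L ^ (((N : ℝ) - 1) / N) ≤ eLpNorm V q μ := by
    have h1 := eLpNorm_indicator_const₀ (c := M) hLm hq0 ENNReal.ofReal_ne_top
    rw [ENNReal.toReal_ofReal hqr.le, one_div_div, ← ofReal_norm, Real.norm_of_nonneg hM.le] at h1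
    rw [← h1]
    refine eLpNorm_mono fun x => ?_
    by_cases hx : x ∈ L
    · rw [indicator_of_mem hx, Real.norm_of_nonneg hM.le]
      exact (hBM _ hx).trans (le_abs_self _)
    · rw [indicator_of_notMem hx, norm_zero]
      exact norm_nonneg _
  set d := radialWidth Ω P
  have hd0 : 0 ≤ d := radialWidth_nonneg
  set B := sobolevConst Ω * (d + 1) with hBdef
  have hBpos : 0 < B := by positivity
  have hchain : ENNReal.ofReal M * μ L ^ (((N : ℝ) - 1) / N) ≤
      ENNReal.ofReal B * (ENNReal.ofReal ((M * Φ / c₁) ^ (1 / (N : ℝ))) *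
        μ S ^ (((N : ℝ) - 1) / N)) := by
    calc _ ≤ eLpNorm V q μ := hlow
      _ ≤ ENNReal.ofReal (sobolevConst Ω) * (eLpNorm V 1 μ + eLpNorm DV 1 μ) := hsob
      _ ≤ ENNReal.ofReal (sobolevConst Ω) *
          (ENNReal.ofReal d * eLpNorm DV 1 μ + eLpNorm DV 1 μ) := by gcongr
      _ = ENNReal.ofReal B * eLpNorm DV 1 μ := by
          rw [hBdef, ENNReal.ofReal_mul hSpos.le, ENNReal.ofReal_add hd0 zero_le_one,
            ENNReal.ofReal_one]
          ring
      _ ≤ _ := by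
          gcongr
          exact hDVF.trans hF1
  refine mul_le_of_rpow_le (n := N) (by linarith) hM hBpos hc₁ hΦ0 measureReal_nonneg
    measureReal_nonneg ?_
  have hexp : 0 ≤ ((N : ℝ) - 1) / N := div_nonneg (by linarith) (by linarith)
  have hSfin : μ S ^ (((N : ℝ) - 1) / N) ≠ ⊤ :=
    ENNReal.rpow_ne_top_of_nonneg hexp (measure_ne_top μ S)
  have hreal := ENNReal.toReal_mono (ENNReal.mul_ne_top ENNReal.ofReal_ne_top
    (ENNReal.mul_ne_top ENNReal.ofReal_ne_top hSfin)) hchain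
  rw [ENNReal.toReal_mul, ENNReal.toReal_mul, ENNReal.toReal_mul, ENNReal.toReal_ofReal hM.le,
    ENNReal.toReal_ofReal hBpos.le, ENNReal.toReal_ofReal (by positivity),
    ← ENNReal.toReal_rpow, ← ENNReal.toReal_rpow, ← mul_assoc] at hreal
  exact hreal

end LevelSetEstimate

/-! ### From level sets to exponential integrability -/

section ExponentialDecay

open Filter Topology

variable {α : Type*} [MeasurableSpace α] {μ : Measure α} {X : α → ℝ} {A : ℝ}

/-- Iterating the level set inequality with `n` equal steps and letting `n → ∞` gives exponential
decay of the distribution function. -/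
theorem measureReal_lt_le_exp [IsFiniteMeasure μ] (hA : 0 < A)
    (hlevel : ∀ k t, 0 ≤ k → 0 < t →
      (t + A) * μ.real {x | k + t < X x} ≤ A * μ.real {x | k < X x}) {s : ℝ} (hs : 0 < s) :
    μ.real {x | s < X x} ≤ μ.real univ * Real.exp (-(s / A)) := by
  have hstep : ∀ t, 0 < t → ∀ j : ℕ,
      (1 + t / A) ^ j * μ.real {x | j * t < X x} ≤ μ.real univ := by
    intro t ht j
    induction j with
    | zero => simpa using measureReal_mono (subset_univ _)
    | succ j ih =>
      have h1 := hlevel (j * t) t (by positivity) ht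
      have h2 : (1 + t / A) * μ.real {x | j * t + t < X x} ≤ μ.real {x | j * t < X x} := by
        refine le_of_mul_le_mul_left ?_ hA
        refine le_trans (le_of_eq ?_) h1
        field_simp
        ring
      have e : ((j + 1 : ℕ) : ℝ) * t = j * t + t := by push_cast; ring
      rw [e, pow_succ, mul_assoc]
      exact (mul_le_mul_of_nonneg_left h2 (by positivity)).trans ih
  have hn : ∀ᶠ n : ℕ in atTop, (1 + s / A / n) ^ n * μ.real {x | s < X x} ≤ μ.real univ := by
    filter_upwards [eventually_gt_atTop 0] with n hn
    have hn0 : (0 : ℝ) < n := by exact_mod_cast hn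
    have := hstep (s / n) (by positivity) n
    rwa [mul_div_cancel₀ _ hn0.ne', div_right_comm] at this
  have hlim : Tendsto (fun n : ℕ => (1 + s / A / n) ^ n * μ.real {x | s < X x}) atTop
      (𝓝 (Real.exp (s / A) * μ.real {x | s < X x})) :=
    (Real.tendsto_one_add_div_pow_exp (s / A)).mul_const _
  have h := le_of_tendsto hlim hn
  rw [Real.exp_neg, ← div_eq_mul_inv, le_div_iff₀ (Real.exp_pos _), mul_comm]
  exact h

/-- Exponential integrability from the level set inequality. -/
theorem lintegral_exp_le_of_level_sets [IsFiniteMeasure μ] (hX : AEMeasurable X μ)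
    (hX0 : ∀ x, 0 ≤ X x) (hA : 0 ≤ A)
    (hlevel : ∀ k t, 0 ≤ k → 0 < t →
      (t + A) * μ.real {x | k + t < X x} ≤ A * μ.real {x | k < X x})
    {lam : ℝ} (hlam : 0 < lam) (hlamA : lam * A < 1) :
    ∫⁻ x, ENNReal.ofReal (Real.exp (lam * X x)) ∂μ ≤
      ENNReal.ofReal (μ.real univ / (1 - lam * A)) := by
  rcases hA.eq_or_lt with rfl | hA
  · -- For `A = 0` all level sets are null, so `X = 0` almost everywhere.
    have h0 : ∀ᵐ x ∂μ, ∀ n : ℕ, X x ≤ 1 / ((n : ℝ) + 1) := by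
      rw [ae_all_iff]
      intro n
      have h1 := hlevel 0 (1 / ((n : ℝ) + 1)) le_rfl (by positivity)
      rw [zero_add, add_zero, zero_mul] at h1
      have h2 : μ.real {x | 1 / ((n : ℝ) + 1) < X x} = 0 :=
        le_antisymm (nonpos_of_mul_nonpos_right h1 (by positivity)) measureReal_nonneg
      rw [measureReal_eq_zero_iff] at h2
      rw [ae_iff]
      simpa using h2
    have h1 : ∀ᵐ x ∂μ, ENNReal.ofReal (Real.exp (lam * X x)) = 1 := by
      filter_upwards [h0] with x hx
      have : X x = 0 := le_antisymm
        (ge_of_tendsto' tendsto_one_div_add_atTop_nhds_zero_nat hx) (hX0 x)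
      simp [this]
    rw [lintegral_congr_ae h1]
    simp
  have hAlam : 0 < 1 / A - lam := by
    rw [sub_pos, lt_div_iff₀ hA]; exact hlamA
  have hprim : ∀ a : ℝ, ∫ t in (0 : ℝ)..a, lam * Real.exp (lam * t) = Real.exp (lam * a) - 1 := by
    intro a
    have hd : ∀ t : ℝ, HasDerivAt (fun t => Real.exp (lam * t)) (lam * Real.exp (lam * t)) t := by
      intro t
      have := ((hasDerivAt_id t).const_mul lam).exp
      simpa [mul_comm] using this
    rw [intervalIntegral.integral_eq_sub_of_hasDerivAt (fun t _ => hd t)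
      ((by fun_prop : Continuous fun t => lam * Real.exp (lam * t)).intervalIntegrable _ _)]
    simp
  have hcake := lintegral_comp_eq_lintegral_meas_lt_mul μ (f := X)
    (g := fun t => lam * Real.exp (lam * t)) (Eventually.of_forall hX0) hX
    (fun t _ => (by fun_prop : Continuous fun t => lam * Real.exp (lam * t)).intervalIntegrable _ _)
    (Eventually.of_forall fun t => by positivity)
  simp only [hprim] at hcake
  have hbound : ∫⁻ t in Ioi (0 : ℝ), μ {x | t < X x} * ENNReal.ofReal (lam * Real.exp (lam * t)) ≤
      ENNReal.ofReal (μ.real univ * lam / (1 / A - lam)) := by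
    have hint : IntegrableOn (fun t => μ.real univ * lam * Real.exp (-(1 / A - lam) * t))
        (Ioi 0) := (integrableOn_exp_mul_Ioi (by linarith) 0).const_mul _
    have hval : ∫ t in Ioi (0 : ℝ), μ.real univ * lam * Real.exp (-(1 / A - lam) * t) =
        μ.real univ * lam / (1 / A - lam) := by
      rw [integral_const_mul, integral_exp_mul_Ioi (by linarith) 0]
      simp only [mul_zero, Real.exp_zero, neg_div_neg_eq]
      ring
    rw [← hval, ofReal_integral_eq_lintegral_ofReal hint
      (Eventually.of_forall fun t => by positivity)]
    refine setLIntegral_mono' measurableSet_Ioi fun t ht => ?_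
    rw [← ofReal_measureReal, ← ENNReal.ofReal_mul measureReal_nonneg]
    refine ENNReal.ofReal_le_ofReal ?_
    have h1 := measureReal_lt_le_exp hA hlevel ht
    calc μ.real {x | t < X x} * (lam * Real.exp (lam * t))
        ≤ μ.real univ * Real.exp (-(t / A)) * (lam * Real.exp (lam * t)) := by gcongr
      _ = μ.real univ * lam * (Real.exp (-(t / A)) * Real.exp (lam * t)) := by ring
      _ = _ := by rw [← Real.exp_add]; congr 2; ring
  calc ∫⁻ x, ENNReal.ofReal (Real.exp (lam * X x)) ∂μ
      = ∫⁻ x, (1 + ENNReal.ofReal (Real.exp (lam * X x) - 1)) ∂μ := by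
        refine lintegral_congr fun x => ?_
        have : 1 ≤ Real.exp (lam * X x) := Real.one_le_exp (mul_nonneg hlam.le (hX0 x))
        rw [← ENNReal.ofReal_one, ← ENNReal.ofReal_add zero_le_one (by linarith), add_sub_cancel]
    _ = μ univ + ∫⁻ x, ENNReal.ofReal (Real.exp (lam * X x) - 1) ∂μ := by
        rw [lintegral_add_left measurable_const, lintegral_const, one_mul]
    _ ≤ ENNReal.ofReal (μ.real univ) + ENNReal.ofReal (μ.real univ * lam / (1 / A - lam)) := by
        rw [hcake, ofReal_measureReal]
        gcongr
    _ = _ := by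
        rw [← ENNReal.ofReal_add measureReal_nonneg (by positivity)]
        congr 1
        have h1 : 1 - lam * A ≠ 0 := by linarith
        have h2 : 1 / A - lam ≠ 0 := hAlam.ne'
        field_simp
        ring

end ExponentialDecay

/-! ### The level set inequality and the exponential estimate -/

section LevelSetInequality

open Filter Topology

variable {N : ℕ} {H : EuclideanSpace ℝ (Fin N) → ℝ} {Ω Γ : Set (EuclideanSpace ℝ (Fin N))}
  {P : EuclideanSpace ℝ (Fin N)}

/-- The level set inequality `(t + A) m(k + t) ≤ A m(k)` for `m(s) = |{s < |u - h|}|` and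
`A = μ_Ω⁻¹ ‖f‖₁ ^ (1 / (N - 1))`: let the height of the truncation tend to `t`. -/
theorem level_set_inequality (hN : 2 ≤ N) (hH : IsGauge H) (hC2 : ContDiffOn ℝ 2 H {0}ᶜ) {c₁ : ℝ}
    (hc₁ : 0 < c₁)
    (hmono : ∀ ξ₁ ξ₂ : EuclideanSpace ℝ (Fin N), c₁ * (‖ξ₁‖ + ‖ξ₂‖) ^ (N - 2) * ‖ξ₁ - ξ₂‖ ^ 2 ≤
      inner ℝ (finslerField H ξ₁ - finslerField H ξ₂) (ξ₁ - ξ₂))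
    (hΩ : IsOpen Ω) (hb : Bornology.IsBounded Ω) (hS : IsSobolevConst Ω (sobolevConst Ω))
    (hSpos : 0 < sobolevConst Ω) (hP : PropertyP Ω P) (hΓ : backContactSet Ω P ⊆ Γ)
    {f u h : EuclideanSpace ℝ (Fin N) → ℝ}
    {Du Dh : EuclideanSpace ℝ (Fin N) → EuclideanSpace ℝ (Fin N)} (hf : IntegrableOn f Ω)
    (hu : MemSobolev (N : ℝ≥0∞) Ω u Du) (hh : MemSobolev (N : ℝ≥0∞) Ω h Dh)
    (hus : IsWeakSolution H Ω Γ Du f) (hhs : IsWeakSolution H Ω Γ Dh 0)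
    (hv : VanishesOn Ω Γ (u - h) (Du - Dh)) {k t : ℝ} (hk : 0 ≤ k) (ht : 0 < t) :
    (t + (muConst c₁ Ω P)⁻¹ * (∫ x in Ω, |f x|) ^ (1 / ((N : ℝ) - 1))) *
        (volume.restrict Ω).real {x | k + t < |(u - h) x|} ≤
      (muConst c₁ Ω P)⁻¹ * (∫ x in Ω, |f x|) ^ (1 / ((N : ℝ) - 1)) *
        (volume.restrict Ω).real {x | k < |(u - h) x|} := by
  set A := (muConst c₁ Ω P)⁻¹ * (∫ x in Ω, |f x|) ^ (1 / ((N : ℝ) - 1))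
  have hA0 : 0 ≤ A := mul_nonneg (inv_nonneg.2 (muConst_pos hc₁ hSpos).le)
    (Real.rpow_nonneg (integral_nonneg fun x => abs_nonneg _) _)
  set μ := volume.restrict Ω with hμ
  have : IsFiniteMeasure μ := ⟨by
    rw [hμ, Measure.restrict_apply_univ]; exact hb.measure_lt_top⟩
  have hwm : AEMeasurable (fun x => |(u - h) x|) μ :=
    hv.1.memLp.aestronglyMeasurable.norm.aemeasurable
  set S : Set (EuclideanSpace ℝ (Fin N)) := {x | k < |(u - h) x| ∧ |(u - h) x| < k + t}
  set L : Set (EuclideanSpace ℝ (Fin N)) := {x | k + t ≤ |(u - h) x|}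
  have hLm : NullMeasurableSet L μ := nullMeasurableSet_le aemeasurable_const hwm
  have hdisj : Disjoint S L := Set.disjoint_left.2 fun x hx hx' => not_lt.2 hx' hx.2
  have hunion : μ.real S + μ.real L ≤ μ.real {x | k < |(u - h) x|} := by
    rw [← measureReal_union₀ hLm hdisj.aedisjoint]
    refine measureReal_mono ?_
    rintro x (hx | hx)
    · exact hx.1
    · exact lt_of_lt_of_le (by linarith) (show k + t ≤ |(u - h) x| from hx)
  have hsub : μ.real {x | k + t < |(u - h) x|} ≤ μ.real L :=
    measureReal_mono fun x hx => le_of_lt (show k + t < |(u - h) x| from hx)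
  have hτ : ∀ τ ∈ Ioo 0 t, τ * μ.real L ≤ A * μ.real S := by
    intro τ hτ
    obtain ⟨M, hM, hle⟩ := exists_height_mul_le hN hH hC2 hc₁ hmono hΩ hb hS hSpos hP hΓ hf hu hh
      hus hhs hv hk hτ.1 hτ.2
    exact (mul_le_mul_of_nonneg_right hM measureReal_nonneg).trans hle
  have hlim : t * μ.real L ≤ A * μ.real S := by
    have h1 : Tendsto (fun τ : ℝ => τ * μ.real L) (𝓝[<] t) (𝓝 (t * μ.real L)) :=
      ((continuous_id.mul continuous_const).tendsto t).mono_left nhdsWithin_le_nhds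
    refine le_of_tendsto h1 ?_
    filter_upwards [Ioo_mem_nhdsLT ht] with τ h using hτ τ h
  calc (t + A) * μ.real {x | k + t < |(u - h) x|} ≤ (t + A) * μ.real L := by gcongr
    _ = t * μ.real L + A * μ.real L := by ring
    _ ≤ A * μ.real S + A * μ.real L := by gcongr
    _ = A * (μ.real S + μ.real L) := by ring
    _ ≤ _ := by gcongr

end LevelSetInequality

theorem lemmaA2 (N : ℕ) (hN : 2 ≤ N) (H : EuclideanSpace ℝ (Fin N) → ℝ)
    (hH : IsGauge H) (hC2 : ContDiffOn ℝ 2 H {0}ᶜ) (hell : UniformlyElliptic H) :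
    -- the constant `c₁` depends on `N` and `H` only
    ∃ c₁ : ℝ, 0 < c₁ ∧
      (∀ ξ₁ ξ₂ : EuclideanSpace ℝ (Fin N), ξ₁ ≠ 0 → ξ₂ ≠ 0 →
        c₁ * (‖ξ₁‖ + ‖ξ₂‖) ^ (N - 2) * ‖ξ₁ - ξ₂‖ ^ 2 ≤
          inner ℝ (finslerField H ξ₁ - finslerField H ξ₂) (ξ₁ - ξ₂)) ∧
      ∀ Ω : Set (EuclideanSpace ℝ (Fin N)), IsOpen Ω → IsConnected Ω → Bornology.IsBounded Ω →
        -- the embedding of `W^{1,1}(Ω)` into `L^{N/(N-1)}(Ω)` holds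
        (∃ S : ℝ, IsSobolevConst Ω S) →
        ∀ P : EuclideanSpace ℝ (Fin N), PropertyP Ω P →
          0 < muConst c₁ Ω P ∧
          ∀ (Γ : Set (EuclideanSpace ℝ (Fin N))) (f u h : EuclideanSpace ℝ (Fin N) → ℝ)
            (Du Dh : EuclideanSpace ℝ (Fin N) → EuclideanSpace ℝ (Fin N)),
            backContactSet Ω P ⊆ Γ → Γ ⊆ frontier Ω →
            IntegrableOn f Ω →
            MemSobolev (N : ℝ≥0∞) Ω u Du → MemSobolev (N : ℝ≥0∞) Ω h Dh →
            IsWeakSolution H Ω Γ Du f → IsWeakSolution H Ω Γ Dh 0 →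
            VanishesOn Ω Γ (u - h) (Du - Dh) →
            -- the condition on `lam` is `0 < lam < μ_Ω ‖f‖₁^{-1/(N-1)}`, with `1 / 0 = ∞`
            ∀ lam : ℝ, 0 < lam →
              lam * (∫ x in Ω, |f x|) ^ (1 / ((N : ℝ) - 1)) < muConst c₁ Ω P →
              ∫⁻ x in Ω, ENNReal.ofReal (Real.exp (lam * |u x - h x|)) ≤
                ENNReal.ofReal (volume.real Ω /
                  (1 - lam * (muConst c₁ Ω P)⁻¹ *
                    (∫ x in Ω, |f x|) ^ (1 / ((N : ℝ) - 1)))) := by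
  obtain ⟨c₁, hc₁, hmono⟩ := exists_finslerField_strongly_monotone hN hH hC2 hell
  refine ⟨c₁, hc₁, fun ξ₁ ξ₂ _ _ => hmono ξ₁ ξ₂, ?_⟩
  intro Ω hΩ hconn hb hex P hP
  obtain ⟨hS, hSpos⟩ := isSobolevConst_sobolevConst hN
    (hΩ.measure_pos volume hconn.nonempty).ne' hb.measure_lt_top.ne hex
  have hmu : 0 < muConst c₁ Ω P := muConst_pos hc₁ hSpos
  refine ⟨hmu, ?_⟩
  intro Γ f u h Du Dh hΓ _ hf hu hh hus hhs hv lam hlam hlt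
  have : IsFiniteMeasure (volume.restrict Ω) := ⟨by
    rw [Measure.restrict_apply_univ]; exact hb.measure_lt_top⟩
  have hfin := lintegral_exp_le_of_level_sets (μ := volume.restrict Ω)
    (X := fun x => |(u - h) x|)
    (A := (muConst c₁ Ω P)⁻¹ * (∫ x in Ω, |f x|) ^ (1 / ((N : ℝ) - 1)))
    hv.1.memLp.aestronglyMeasurable.norm.aemeasurable (fun x => abs_nonneg _)
    (mul_nonneg (inv_nonneg.2 hmu.le)
      (Real.rpow_nonneg (integral_nonneg fun x => abs_nonneg _) _))
    (fun k t hk ht => level_set_inequality hN hH hC2 hc₁ hmono hΩ hb hS hSpos hP hΓ hf hu hh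
      hus hhs hv hk ht) hlam
    (by
      rw [mul_left_comm, inv_mul_lt_iff₀ hmu, mul_one]
      exact hlt)
  rw [measureReal_restrict_apply_univ, ← mul_assoc] at hfin
  exact hfin
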